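/- There are absolute constants $C_1,C_2,C_3>0$ such that the following holds for every $\varepsilon\in(0,1]$ and every $c\in\mathbb N$. There is a deterministic distributed algorithm that, on every finite bipartite graph $G$ with $n$ nodes and maximum degree $\Delta$ that is equipped with a proper 2-coloring of its nodes, and for all edge parameters $\lambda_e\in[0,1]$ ($e\in E(G)$), computes within $C_1\log_2^4\Delta/\varepsilon^6$ rounds of the CONGEST model a generalized $(1+\varepsilon,\beta)$-relaxed defective 2-edge coloring of $G$, where $\beta=C_2\log_2^3\Delta/\varepsilon^5$ (for $\Delta=0$ we read $\log_2\Delta$ as $0$). Here a generalized $(1+\varepsilon,\beta)$-relaxed defective 2-edge coloring with respect to the parameters $\lambda_e$ is an assignment of the colors red and blue to the edges of $G$ such that every red edge $e$ has at most $(1+\varepsilon)\lambda_e\deg(e)+\lambda_e\beta$ neighboring red edges and every blue edge $e$ has at most $(1+\varepsilon)(1-\lambda_e)\deg(e)+(1-\lambda_e)\beta$ neighboring blue edges, where two distinct edges are neighbors if they share an endpoint and $\deg(e)$ is the number of neighboring edges of $e$. In the CONGEST model, the nodes of $G$ communicate along the edges of $G$ in synchronous rounds; in each round every node sends a (possibly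 different) message of at most $C_3\log_2 n$ bits to each of its neighbors, receives the messages of its neighbors, and updates its state by an arbitrary deterministic computation. A node distinguishes its neighbors by an arbitrary local port numbering. Initially every node knows $n$, $\Delta$, $\varepsilon$, its unique identifier from $\{1,\dots,n^c\}$, its own color in the given 2-coloring of the nodes, its degree, and the values $\lambda_e$ of its incident edges. At the end every node outputs the colors of all its incident edges, and the two endpoints of an edge output the same color for it. -/

import Mathlib

/-! ## Generalized relaxed defective 2-edge colorings -/

inductive EdgeColor where
  | red
  | blue

/-- The degree of an edge: the number of edges of `G` that are adjacent to it, that is, its degree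
in the line graph. -/
noncomputable def edgeDegree {V : Type*} (G : SimpleGraph V) (e : G.edgeSet) : ℕ :=
  (G.lineGraph.neighborSet e).ncard

/-- The number of neighboring edges of `e` that have color `c`. -/
noncomputable def numNeighborsOfColor {V : Type*} (G : SimpleGraph V)
    (col : G.edgeSet → EdgeColor) (e : G.edgeSet) (c : EdgeColor) : ℕ :=
  {f : G.edgeSet | G.lineGraph.Adj e f ∧ col f = c}.ncard

/-- `col` is a generalized `(1 + ε, β)`-relaxed defective 2-edge coloring of `G` with respect to
the edge parameters `lam`. -/
def IsRelaxedDefectiveTwoEdgeColoring {V : Type*} (G : SimpleGraph V) (ε β : ℝ)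
    (lam : G.edgeSet → ℝ) (col : G.edgeSet → EdgeColor) : Prop :=
  ∀ e : G.edgeSet,
    (col e = EdgeColor.red →
      (numNeighborsOfColor G col e EdgeColor.red : ℝ) ≤
        (1 + ε) * lam e * edgeDegree G e + lam e * β) ∧
    (col e = EdgeColor.blue →
      (numNeighborsOfColor G col e EdgeColor.blue : ℝ) ≤
        (1 + ε) * (1 - lam e) * edgeDegree G e + (1 - lam e) * β)

/-! ## Deterministic synchronous message passing -/

/-- A deterministic synchronous message-passing algorithm, executed by every node of a network.
A node of degree `d` addresses its neighbors only through its ports `0, …, d - 1`.  Local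
computation is unrestricted, and messages are bit strings (the empty string plays the role of
sending no message).

`NodeIn` and `PortIn` are the types of the problem input at a node and at each of its ports, and
`PortOut` is the type of the output that a node has to produce at each of its ports. -/
structure DistributedAlgorithm (NodeIn PortIn PortOut : Type) where
  /-- The local states of a node of degree `d`. -/
  State : ℕ → Type
  /-- The initial state, computed from the number `n` of nodes, the maximum degree `Δ`,
  the identifier of the node, and its input. -/
  init : (n Δ ident : ℕ) → NodeIn → {d : ℕ} → (Fin d → PortIn) → State d
  /-- The message sent through each port. -/
  send : {d : ℕ} → State d → Fin d → List Bool
  /-- The new state, computed from the old state and the messages received on the ports. -/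
  receive : {d : ℕ} → State d → (Fin d → List Bool) → State d
  /-- The number of rounds after which all nodes stop; it may depend on `n` and `Δ` only, both of
  which are known to all nodes. -/
  rounds : (n Δ : ℕ) → ℕ
  /-- The output, read off the final state. -/
  output : {d : ℕ} → State d → Fin d → PortOut

section Execution

variable {V : Type*} [Fintype V] (G : SimpleGraph V) [DecidableRel G.Adj]

/-- A port numbering: every node numbers its incident edges (equivalently, its neighbors)
arbitrarily by `0, …, deg v - 1`. -/
abbrev PortNumbering : Type _ := ∀ v : V, Fin (G.degree v) ≃ G.neighborSet v

variable {G}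

/-- The neighbor of `v` behind port `i`. -/
def PortNumbering.nbr (port : PortNumbering G) (v : V) (i : Fin (G.degree v)) : V :=
  (port v i : V)

theorem PortNumbering.adj_nbr (port : PortNumbering G) (v : V) (i : Fin (G.degree v)) :
    G.Adj v (port.nbr v i) :=
  (port v i).2

/-- The edge of `G` at port `i` of `v`. -/
def PortNumbering.edge (port : PortNumbering G) (v : V) (i : Fin (G.degree v)) : G.edgeSet :=
  ⟨s(v, port.nbr v i), port.adj_nbr v i⟩

/-- The port of the neighbor of `v` behind port `i` that leads back to `v`. -/
def PortNumbering.back (port : PortNumbering G) (v : V) (i : Fin (G.degree v)) :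
    Fin (G.degree (port.nbr v i)) :=
  (port (port.nbr v i)).symm ⟨v, (port.adj_nbr v i).symm⟩

namespace DistributedAlgorithm

variable {NodeIn PortIn PortOut : Type} (A : DistributedAlgorithm NodeIn PortIn PortOut)
  (port : PortNumbering G) (ident : V → ℕ) (nodeIn : V → NodeIn) (edgeIn : G.edgeSet → PortIn)

/-- The states of all nodes after `t` rounds.  Every edge carries an input, which is known to both
of its endpoints. -/
def run : ℕ → (v : V) → A.State (G.degree v)
  | 0 => fun v =>
      A.init (Fintype.card V) G.maxDegree (ident v) (nodeIn v) fun i => edgeIn (port.edge v i)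
  | t + 1 => fun v =>
      A.receive (run t v) fun i => A.send (run t (port.nbr v i)) (port.back v i)

/-- The output of node `v` at its port `i` when the algorithm stops. -/
def finalOutput (v : V) (i : Fin (G.degree v)) : PortOut :=
  A.output (A.run port ident nodeIn edgeIn (A.rounds (Fintype.card V) G.maxDegree) v) i

/-- During the execution, every message has at most `b` bits. -/
def MessagesBounded (b : ℝ) : Prop :=
  ∀ t < A.rounds (Fintype.card V) G.maxDegree, ∀ (v : V) (i : Fin (G.degree v)),
    ((A.send (A.run port ident nodeIn edgeIn t v) i).length : ℝ) ≤ b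

end DistributedAlgorithm

end Execution

/-! Instead of coloring edges, orient them: an edge pointing to a node of side `true` is red, one
pointing to a node of side `false` is blue. Let x_v be the number of edges oriented towards v. At
the tail w of an edge from w to u, the edges with the color of that edge are those oriented away
from w. Hence the edge has exactly x_u - x_w + deg w - 2 neighbors of its own color. The task
becomes to find an orientation in which x_u - x_w exceeds a prescribed bias only slightly. The bias
changes sign with the direction, and `threshold` is placed so that an excess of (ε deg(e) + β)/2 is
affordable for either color.

Edges are oriented in phases. In phase i an undecided edge proposes to the end at which its
difference respects the bias, and each node adopts at most `cap i` edges. These new edges are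
tokens, and flipping an older edge moves a token to its other end. Token dropping spreads the tokens
so that the imbalance of an edge does not grow by a full cap in every phase. By
`TokenDropping.surplus_le`, if an edge could have been flipped throughout the phase but was not, its
difference grows only by a few bandwidths plus `retire` times (R + 2)^2. Any other oriented edge
respected the bias, in its final direction, at the start of the phase, and gains at most one cap.
Thus the excess of an edge is one cap plus one small error per phase (`BalancingInvariant.phase`),
which `total_error_le` bounds by the tolerance.

An edge takes part only when the cap is small compared with its degree sum D, so one cap is
affordable. If it takes part and stays undecided, one of its ends has adopted `cap i` edges. The
caps are halved from stage to stage, and those of a single stage already exceed D (`lt_sum_cap`), so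
every edge is eventually oriented. There are O(log Δ / ε) phases of O(log³ Δ / ε⁵) rounds each. -/

/-! ## Token dropping -/

/-- A donor holds enough tokens to give away `α` of them and to retire `δ` of them. -/
def IsDonor (δ α x₀ cnt p : ℕ) : Prop := x₀ + p + α + δ ≤ cnt

/-- A receiver is not a donor and has room for `α` further tokens. -/
def IsReceiver (k δ α x₀ cnt p : ℕ) : Prop := ¬ IsDonor δ α x₀ cnt p ∧ cnt + α ≤ x₀ + k

/-- An execution of `T` rounds of token dropping on a port-numbered network.  In round `t`, node `v`
holds `cnt t v - x₀ v` tokens, of which `p t v` are retired; `out` and `inn` are the ports through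
which tokens can still leave and enter, `off` the ports on which tokens are offered, `flip` and
`acc` the ports through which tokens leave and enter. -/
structure TokenDropping {V : Type*} {deg : V → ℕ}
    (rev : (Σ v, Fin (deg v)) → Σ v, Fin (deg v)) (R T k δ : ℕ) (α x₀ : V → ℕ)
    (cnt p : ℕ → V → ℕ) (out inn off flip acc : ℕ → ∀ v, Finset (Fin (deg v))) : Prop where
  deg_le : ∀ v, deg v ≤ R * α v
  alpha_pos : ∀ v, 0 < α v
  le_mul : k ≤ δ * T
  rev_rev : ∀ e, rev (rev e) = e
  p_zero : ∀ v, p 0 v = 0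
  le_cnt_zero : ∀ v, x₀ v ≤ cnt 0 v
  cnt_zero_le : ∀ v, cnt 0 v ≤ x₀ v + k
  off_sub : ∀ t < T, ∀ v, off t v ⊆ out t v
  off_card : ∀ t < T, ∀ v, (off t v).card ≤ α v
  off_donor : ∀ t < T, ∀ v, (off t v).Nonempty → IsDonor δ (α v) (x₀ v) (cnt t v) (p t v)
  off_receiver : ∀ t < T, ∀ e : Σ v, Fin (deg v), e.2 ∈ off t e.1 →
    IsReceiver k δ (α (rev e).1) (x₀ (rev e).1) (cnt t (rev e).1) (p t (rev e).1)
  off_full : ∀ t < T, ∀ e : Σ v, Fin (deg v), e.2 ∈ out t e.1 → e.2 ∉ off t e.1 →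
    IsDonor δ (α e.1) (x₀ e.1) (cnt t e.1) (p t e.1) →
    IsReceiver k δ (α (rev e).1) (x₀ (rev e).1) (cnt t (rev e).1) (p t (rev e).1) →
    α e.1 ≤ (off t e.1).card
  flip_sub : ∀ t < T, ∀ v, flip t v ⊆ off t v
  mem_flip : ∀ t < T, ∀ e : Σ v, Fin (deg v), e.2 ∈ flip t e.1 ↔ (rev e).2 ∈ acc t (rev e).1
  acc_sub : ∀ t < T, ∀ v, acc t v ⊆ inn t v
  acc_card : ∀ t < T, ∀ v, (acc t v).card ≤ α v
  acc_full : ∀ t < T, ∀ e : Σ v, Fin (deg v), e.2 ∈ off t e.1 → (rev e).2 ∉ acc t (rev e).1 →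
    α (rev e).1 ≤ (acc t (rev e).1).card
  out_succ : ∀ t < T, ∀ v, out (t + 1) v = out t v \ flip t v
  inn_succ : ∀ t < T, ∀ v, inn (t + 1) v = inn t v \ acc t v
  cnt_succ : ∀ t < T, ∀ v, cnt (t + 1) v + (flip t v).card = cnt t v + (acc t v).card
  p_succ_donor : ∀ t < T, ∀ v, IsDonor δ (α v) (x₀ v) (cnt t v) (p t v) →
    p (t + 1) v = p t v + δ
  p_succ : ∀ t < T, ∀ v, ¬ IsDonor δ (α v) (x₀ v) (cnt t v) (p t v) → p (t + 1) v = p t v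

namespace TokenDropping

variable {V : Type*} {deg : V → ℕ} {rev : (Σ v, Fin (deg v)) → Σ v, Fin (deg v)}
  {R T k δ : ℕ} {α x₀ : V → ℕ} {cnt p : ℕ → V → ℕ}
  {out inn off flip acc : ℕ → ∀ v, Finset (Fin (deg v))}

/-! ### Bounds on the tokens held and retired by a node -/

theorem flip_eq_empty (h : TokenDropping rev R T k δ α x₀ cnt p out inn off flip acc) {t : ℕ}
    (ht : t < T) {v : V} (hv : ¬ IsDonor δ (α v) (x₀ v) (cnt t v) (p t v)) : flip t v = ∅ := by
  rw [Finset.eq_empty_iff_forall_notMem]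
  exact fun i hi => hv (h.off_donor t ht v ⟨i, h.flip_sub t ht v hi⟩)

theorem acc_eq_empty (h : TokenDropping rev R T k δ α x₀ cnt p out inn off flip acc) {t : ℕ}
    (ht : t < T) {v : V} (hv : ¬ IsReceiver k δ (α v) (x₀ v) (cnt t v) (p t v)) :
    acc t v = ∅ := by
  rw [Finset.eq_empty_iff_forall_notMem]
  intro i hi
  have h1 := (h.mem_flip t ht (rev ⟨v, i⟩)).2 (by rw [h.rev_rev]; exact hi)
  have h2 := h.off_receiver t ht _ (h.flip_sub t ht _ h1)
  rw [h.rev_rev] at h2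
  exact hv h2

/-- Retired tokens are never given away: the donor condition reserves `α` tokens for the at most `α`
offers and another `δ` for retirement. -/
theorem le_cnt (h : TokenDropping rev R T k δ α x₀ cnt p out inn off flip acc) (v : V) {t : ℕ}
    (ht : t ≤ T) : x₀ v + p t v ≤ cnt t v := by
  induction t with
  | zero => have := h.le_cnt_zero v; have := h.p_zero v; omega
  | succ t ih =>
    have ih := ih (by omega)
    have hc := h.cnt_succ t (by omega) v
    by_cases hd : IsDonor δ (α v) (x₀ v) (cnt t v) (p t v)
    · have h1 := h.p_succ_donor t (by omega) v hd
      have h2 := (Finset.card_le_card (h.flip_sub t (by omega) v)).trans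
        (h.off_card t (by omega) v)
      unfold IsDonor at hd
      omega
    · have h1 := h.p_succ t (by omega) v hd
      rw [h.flip_eq_empty (by omega) hd, Finset.card_empty] at hc
      omega

theorem cnt_le (h : TokenDropping rev R T k δ α x₀ cnt p out inn off flip acc) (v : V) {t : ℕ}
    (ht : t ≤ T) : cnt t v ≤ x₀ v + k := by
  induction t with
  | zero => exact h.cnt_zero_le v
  | succ t ih =>
    have ih := ih (by omega)
    have hc := h.cnt_succ t (by omega) v
    by_cases hd : IsReceiver k δ (α v) (x₀ v) (cnt t v) (p t v)
    · have h2 := h.acc_card t (by omega) v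
      have := hd.2
      omega
    · rw [h.acc_eq_empty (by omega) hd, Finset.card_empty] at hc
      omega

/-- A donor receives nothing and retires `δ` tokens, so its number of active tokens drops by at
least `δ`. A node that is not a donor has fewer than `α + δ` active tokens and receives at most `α`.
-/
theorem cnt_le_max (h : TokenDropping rev R T k δ α x₀ cnt p out inn off flip acc) (v : V) {t : ℕ}
    (ht : t ≤ T) : cnt t v ≤ x₀ v + p t v + max (2 * α v + δ) (k - δ * t) := by
  induction t with
  | zero => have := h.cnt_zero_le v; have := h.p_zero v; simp; omega
  | succ t ih =>
    have ih := ih (by omega)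
    have hc := h.cnt_succ t (by omega) v
    by_cases hd : IsDonor δ (α v) (x₀ v) (cnt t v) (p t v)
    · have h1 := h.p_succ_donor t (by omega) v hd
      rw [h.acc_eq_empty (by omega) (fun hr => hr.1 hd), Finset.card_empty] at hc
      have : δ * (t + 1) = δ * t + δ := by ring
      omega
    · have h1 := h.p_succ t (by omega) v hd
      have h2 := h.acc_card t (by omega) v
      unfold IsDonor at hd
      omega

theorem p_mono (h : TokenDropping rev R T k δ α x₀ cnt p out inn off flip acc) (v : V) {s t : ℕ}
    (hst : s ≤ t) (ht : t ≤ T) : p s v ≤ p t v := by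
  induction t, hst using Nat.le_induction with
  | base => exact le_rfl
  | succ t hst ih =>
    have ih := ih (by omega)
    by_cases hd : IsDonor δ (α v) (x₀ v) (cnt t v) (p t v)
    · have h1 := h.p_succ_donor t (by omega) v hd
      omega
    · have h1 := h.p_succ t (by omega) v hd
      omega

-- This reduces the comparison of retired tokens at two neighbors to a comparison of the rounds in
-- which they are donors.
open scoped Classical in
theorem p_eq (h : TokenDropping rev R T k δ α x₀ cnt p out inn off flip acc) (v : V) {t : ℕ}
    (ht : t ≤ T) : p t v = δ *
      ((Finset.range t).filter fun s => IsDonor δ (α v) (x₀ v) (cnt s v) (p s v)).card := by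
  induction t with
  | zero => simp [h.p_zero v]
  | succ t ih =>
    have ih := ih (by omega)
    rw [Finset.range_add_one, Finset.filter_insert]
    by_cases hd : IsDonor δ (α v) (x₀ v) (cnt t v) (p t v)
    · rw [if_pos hd, Finset.card_insert_of_notMem (by simp), h.p_succ_donor t (by omega) v hd, ih]
      ring
    · rw [if_neg hd, h.p_succ t (by omega) v hd, ih]

/-- A port leaves `inn` once it has been used, so each of the at most `R * α v` ports accepts only
once. -/
theorem sum_card_acc_le (h : TokenDropping rev R T k δ α x₀ cnt p out inn off flip acc) (v : V) :
    ∑ t ∈ Finset.range T, (acc t v).card ≤ R * α v := by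
  have key : ∀ t ≤ T, ∑ s ∈ Finset.range t, (acc s v).card + (inn t v).card = (inn 0 v).card := by
    intro t
    induction t with
    | zero => simp
    | succ t ih =>
      intro ht
      have ih := ih (by omega)
      rw [Finset.sum_range_succ, h.inn_succ t (by omega) v, ← ih,
        Finset.card_sdiff_of_subset (h.acc_sub t (by omega) v)]
      have := Finset.card_le_card (h.acc_sub t (by omega) v)
      omega
  have h1 := key T le_rfl
  have h2 := Finset.card_le_univ (inn 0 v)
  rw [Fintype.card_fin] at h2
  have := h.deg_le v
  omega

theorem mem_out_of_le (h : TokenDropping rev R T k δ α x₀ cnt p out inn off flip acc) {v : V}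
    {i : Fin (deg v)} {s t : ℕ} (hst : s ≤ t) (ht : t ≤ T) (hi : i ∈ out t v) : i ∈ out s v := by
  induction t, hst using Nat.le_induction with
  | base => exact hi
  | succ t hst ih =>
    rw [h.out_succ t (by omega) v, Finset.mem_sdiff] at hi
    exact ih (by omega) hi.1

/-- The number of rounds in which an offer at `e` is declined. -/
theorem card_declined_le (h : TokenDropping rev R T k δ α x₀ cnt p out inn off flip acc)
    (e : Σ v, Fin (deg v)) :
    ((Finset.range T).filter fun t => e.2 ∈ off t e.1 ∧ e.2 ∉ flip t e.1).card ≤ R := by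
  -- Whenever an offer is declined, the target accepts at least `α` other tokens, and in total it
  -- accepts at most `R * α`.
  refine Nat.le_of_mul_le_mul_right ?_ (h.alpha_pos (rev e).1)
  refine le_trans ?_ (h.sum_card_acc_le (rev e).1)
  rw [← smul_eq_mul]
  refine (Finset.card_nsmul_le_sum _ _ _ ?_).trans
    (Finset.sum_le_sum_of_subset (Finset.filter_subset _ _))
  intro t ht
  simp only [Finset.mem_filter, Finset.mem_range] at ht
  refine h.acc_full t ht.1 e ht.2.1 fun hacc => ht.2.2 ?_
  exact (h.mem_flip t ht.1 e).2 hacc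

theorem card_flip_le (h : TokenDropping rev R T k δ α x₀ cnt p out inn off flip acc)
    (e : Σ v, Fin (deg v)) :
    ((Finset.range T).filter fun t => e.2 ∈ flip t e.1).card ≤ 1 := by
  rw [Finset.card_le_one]
  have key : ∀ s t, s < T → t < T → s < t → e.2 ∈ flip s e.1 → e.2 ∈ flip t e.1 → False := by
    intro s t hs ht hst h1 h2
    have h3 := h.off_sub t ht _ (h.flip_sub t ht _ h2)
    have h4 := h.mem_out_of_le (s := s + 1) hst ht.le h3
    rw [h.out_succ s hs, Finset.mem_sdiff] at h4
    exact h4.2 h1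
  intro s hs t ht
  simp only [Finset.mem_filter, Finset.mem_range] at hs ht
  rcases lt_trichotomy s t with hst | hst | hst
  · exact (key s t hs.1 ht.1 hst hs.2 ht.2).elim
  · exact hst
  · exact (key t s ht.1 hs.1 hst ht.2 hs.2).elim

/-- A fixed port is offered at most `R + 1` times: at most `R` offers are declined and at most one
succeeds. -/
theorem sum_card_off_le (h : TokenDropping rev R T k δ α x₀ cnt p out inn off flip acc) (v : V) :
    ∑ t ∈ Finset.range T, (off t v).card ≤ R * α v * (R + 1) := by
  have h1 : ∑ t ∈ Finset.range T, (off t v).card =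
      ∑ i : Fin (deg v), ((Finset.range T).filter fun t => i ∈ off t v).card := by
    simp_rw [Finset.card_filter]
    rw [Finset.sum_comm]
    simp
  rw [h1]
  have h2 : ∀ i ∈ (Finset.univ : Finset (Fin (deg v))),
      ((Finset.range T).filter fun t => i ∈ off t v).card ≤ R + 1 := by
    intro i _
    have h3 := h.card_declined_le ⟨v, i⟩
    have h4 := h.card_flip_le ⟨v, i⟩
    refine le_trans (le_trans (Finset.card_le_card ?_) (Finset.card_union_le _ _))
      (Nat.add_le_add h3 h4)
    intro t ht
    simp only [Finset.mem_filter, Finset.mem_range, Finset.mem_union] at ht ⊢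
    tauto
  refine (Finset.sum_le_card_nsmul _ _ _ h2).trans ?_
  rw [smul_eq_mul, Finset.card_univ, Fintype.card_fin]
  exact Nat.mul_le_mul_right _ (h.deg_le v)

/-- Through every port that is still available in the end, the surplus of tokens is small. -/
theorem surplus_le (h : TokenDropping rev R T k δ α x₀ cnt p out inn off flip acc)
    (e : Σ v, Fin (deg v)) (he : e.2 ∈ out T e.1) :
    cnt T e.1 + x₀ (rev e).1 ≤ cnt T (rev e).1 + x₀ e.1 +
      (2 * α e.1 + 2 * α (rev e).1 + δ * (R + 2) ^ 2) := by
  classical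
  set u := e.1 with hu
  set w := (rev e).1 with hw
  have hδ : δ * (R + 2) ^ 2 = δ * (R + R * (R + 1)) + δ + δ + δ * (2 * R + 2) := by ring
  have hu1 := h.cnt_le_max u le_rfl
  have hu2 := h.cnt_le u le_rfl
  have hw1 := h.le_cnt w le_rfl
  have hk := h.le_mul
  -- If `w` is ever a non-donor without room, more than `k - 2α - δ` of its tokens are already
  -- retired. They stay there, while `u` never holds more than `k` tokens.
  by_cases hroom : ∃ t < T, ¬ IsDonor δ (α w) (x₀ w) (cnt t w) (p t w) ∧
      x₀ w + k < cnt t w + α w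
  · obtain ⟨t, ht, hd, hr⟩ := hroom
    have := h.p_mono w ht.le le_rfl
    unfold IsDonor at hd
    omega
  push Not at hroom
  set DU := (Finset.range T).filter fun s => IsDonor δ (α u) (x₀ u) (cnt s u) (p s u) with hDU
  set DW := (Finset.range T).filter fun s => IsDonor δ (α w) (x₀ w) (cnt s w) (p s w) with hDW
  set A := (Finset.range T).filter fun t => e.2 ∈ off t e.1 ∧ e.2 ∉ flip t e.1 with hA
  set B := (Finset.range T).filter fun t => α u ≤ (off t u).card with hB
  -- A round in which `u` is a donor but `e` is not flipped has one of three causes: `w` is a donor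
  -- too, `w` declines the offer, or `u` spends its bandwidth on other ports. The last two causes
  -- occur at most `R` and `R * (R + 1)` times.
  have hsub : DU ⊆ DW ∪ (A ∪ B) := by
    intro t ht
    simp only [hDU, hDW, hA, hB, Finset.mem_filter, Finset.mem_range, Finset.mem_union] at ht ⊢
    obtain ⟨ht, hdon⟩ := ht
    by_cases hdw : IsDonor δ (α w) (x₀ w) (cnt t w) (p t w)
    · exact Or.inl ⟨ht, hdw⟩
    right
    by_cases hoff : e.2 ∈ off t e.1
    · left
      refine ⟨ht, hoff, fun hf => ?_⟩
      have h4 := h.mem_out_of_le (s := t + 1) ht le_rfl he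
      rw [h.out_succ t ht, Finset.mem_sdiff] at h4
      exact h4.2 hf
    · right
      exact ⟨ht, h.off_full t ht e (h.mem_out_of_le ht.le le_rfl he) hoff hdon
        ⟨hdw, hroom t ht hdw⟩⟩
  have hAc : A.card ≤ R := h.card_declined_le e
  have hBc : B.card ≤ R * (R + 1) := by
    refine Nat.le_of_mul_le_mul_right ?_ (h.alpha_pos u)
    have h5 := h.sum_card_off_le u
    have h6 : B.card * α u ≤ ∑ t ∈ Finset.range T, (off t u).card := by
      rw [← smul_eq_mul]
      refine (Finset.card_nsmul_le_sum _ _ _ ?_).trans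
        (Finset.sum_le_sum_of_subset (Finset.filter_subset _ _))
      intro t ht
      exact (Finset.mem_filter.1 ht).2
    calc B.card * α u ≤ R * α u * (R + 1) := h6.trans h5
      _ = R * (R + 1) * α u := by ring
  have hcard : DU.card ≤ DW.card + (R + R * (R + 1)) := by
    have := Finset.card_le_card hsub
    have := Finset.card_union_le DW (A ∪ B)
    have := Finset.card_union_le A B
    omega
  have hpu : p T u = δ * DU.card := h.p_eq u le_rfl
  have hpw : p T w = δ * DW.card := h.p_eq w le_rfl
  have hmul : δ * DU.card ≤ δ * DW.card + δ * (R + R * (R + 1)) := by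
    rw [← mul_add]
    exact Nat.mul_le_mul_left _ hcard
  -- As `k ≤ δ * T`, the time-dependent term of `cnt_le_max` has vanished by the end: all tokens of
  -- `u` except at most `2α + δ` are retired.
  have hkT : k - δ * T = 0 := by omega
  rw [hkT] at hu1
  omega

end TokenDropping

/-! ## Algorithms that proceed in blocks of three rounds -/

/-- A port-numbering algorithm whose state changes once in three rounds of communication, the
messages of later rounds depending on what has been received in the earlier ones. -/
structure BlockAlgorithm (State : ℕ → Type) where
  msg₁ : {d : ℕ} → State d → Fin d → ℕ
  msg₂ : {d : ℕ} → State d → (Fin d → ℕ) → Fin d → ℕ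
  msg₃ : {d : ℕ} → State d → (Fin d → ℕ) → (Fin d → ℕ) → Fin d → ℕ
  next : {d : ℕ} → State d → (Fin d → ℕ) → (Fin d → ℕ) → (Fin d → ℕ) → State d

namespace BlockAlgorithm

variable {State : ℕ → Type} (B : BlockAlgorithm State)

section Network

variable {V : Type*} {deg : V → ℕ} (rev : (Σ v, Fin (deg v)) → Σ v, Fin (deg v))

/-- The messages received in the first round of a block. -/
def in₁ (s : ∀ v, State (deg v)) (v : V) (i : Fin (deg v)) : ℕ :=
  B.msg₁ (s (rev ⟨v, i⟩).1) (rev ⟨v, i⟩).2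

/-- The messages received in the second round of a block. -/
def in₂ (s : ∀ v, State (deg v)) (v : V) (i : Fin (deg v)) : ℕ :=
  B.msg₂ (s (rev ⟨v, i⟩).1) (B.in₁ rev s (rev ⟨v, i⟩).1) (rev ⟨v, i⟩).2

/-- The messages received in the third round of a block. -/
def in₃ (s : ∀ v, State (deg v)) (v : V) (i : Fin (deg v)) : ℕ :=
  B.msg₃ (s (rev ⟨v, i⟩).1) (B.in₁ rev s (rev ⟨v, i⟩).1) (B.in₂ rev s (rev ⟨v, i⟩).1)
    (rev ⟨v, i⟩).2

/-- The states of all nodes after a block. -/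
def step (s : ∀ v, State (deg v)) (v : V) : State (deg v) :=
  B.next (s v) (B.in₁ rev s v) (B.in₂ rev s v) (B.in₃ rev s v)

end Network

/-- The natural number encoded by a message. -/
def decode (l : List Bool) : ℕ := l.foldr (fun b m => Nat.bit b m) 0

theorem decode_bits (m : ℕ) : decode (Nat.bits m) = m := by
  induction m using Nat.binaryRec' with
  | zero => rfl
  | bit b n hn ih =>
    rw [Nat.bits_append_bit n b hn]
    exact congrArg (Nat.bit b) ih

/-- The distributed algorithm that executes a block algorithm. -/
def compile {NodeIn PortIn PortOut : Type}
    (init : (n Δ ident : ℕ) → NodeIn → {d : ℕ} → (Fin d → PortIn) → State d)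
    (rounds : (n Δ : ℕ) → ℕ) (output : {d : ℕ} → State d → Fin d → PortOut) :
    DistributedAlgorithm NodeIn PortIn PortOut where
  State d := State d × ℕ × (Fin d → ℕ) × (Fin d → ℕ)
  init n Δ ident x _ y := (init n Δ ident x y, 0, 0, 0)
  send
    | (s, 0, _, _), i => Nat.bits (B.msg₁ s i)
    | (s, 1, r₁, _), i => Nat.bits (B.msg₂ s r₁ i)
    | (s, _, r₁, r₂), i => Nat.bits (B.msg₃ s r₁ r₂ i)
  receive
    | (s, 0, _, _), r => (s, 1, fun i => decode (r i), 0)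
    | (s, 1, r₁, _), r => (s, 2, r₁, fun i => decode (r i))
    | (s, _, r₁, r₂), r => (B.next s r₁ r₂ fun i => decode (r i), 0, 0, 0)
  rounds := rounds
  output s i := output s.1 i

variable {V : Type*} [Fintype V] {G : SimpleGraph V} [DecidableRel G.Adj]

/-- The dart opposite to the one that leaves a node through a given port. -/
def _root_.PortNumbering.rev (port : PortNumbering G) (e : Σ v, Fin (G.degree v)) :
    Σ v, Fin (G.degree v) :=
  ⟨port.nbr e.1 e.2, port.back e.1 e.2⟩

variable {NodeIn PortIn PortOut : Type}
  (init : (n Δ ident : ℕ) → NodeIn → {d : ℕ} → (Fin d → PortIn) → State d)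
  (rounds : (n Δ : ℕ) → ℕ) (output : {d : ℕ} → State d → Fin d → PortOut)
  (port : PortNumbering G) (ident : V → ℕ) (nodeIn : V → NodeIn) (edgeIn : G.edgeSet → PortIn)

theorem run_compile (t : ℕ) (v : V) :
    (B.compile init rounds output).run port ident nodeIn edgeIn (3 * t) v =
      (((B.step port.rev)^[t] fun v => init (Fintype.card V) G.maxDegree (ident v) (nodeIn v)
        fun i => edgeIn (port.edge v i)) v, 0, 0, 0) := by
  induction t generalizing v with
  | zero => rfl
  | succ t ih =>
    rw [Function.iterate_succ_apply', show 3 * (t + 1) = 3 * t + 1 + 1 + 1 by ring]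
    set s := (B.step port.rev)^[t] fun v => init (Fintype.card V) G.maxDegree (ident v) (nodeIn v)
      fun i => edgeIn (port.edge v i)
    have h1 : ∀ v, (B.compile init rounds output).run port ident nodeIn edgeIn (3 * t + 1) v =
        (s v, 1, B.in₁ port.rev s v, 0) := by
      intro v
      simp only [DistributedAlgorithm.run, ih]
      simp only [compile, decode_bits]
      rfl
    have h2 : ∀ v, (B.compile init rounds output).run port ident nodeIn edgeIn (3 * t + 1 + 1) v =
        (s v, 2, B.in₁ port.rev s v, B.in₂ port.rev s v) := by
      intro v
      rw [DistributedAlgorithm.run]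
      simp only [h1]
      simp only [compile, decode_bits]
      rfl
    rw [DistributedAlgorithm.run]
    simp only [h2]
    simp only [compile, decode_bits]
    rfl

/-- The bounds are required for all states and all received values, so nothing has to be known about
the reachable ones. -/
theorem messagesBounded_compile {b : ℝ}
    (h₁ : ∀ v (s : State (G.degree v)) i, ((Nat.bits (B.msg₁ s i)).length : ℝ) ≤ b)
    (h₂ : ∀ v (s : State (G.degree v)) r i, ((Nat.bits (B.msg₂ s r i)).length : ℝ) ≤ b)
    (h₃ : ∀ v (s : State (G.degree v)) r r' i, ((Nat.bits (B.msg₃ s r r' i)).length : ℝ) ≤ b) :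
    (B.compile init rounds output).MessagesBounded port ident nodeIn edgeIn b := by
  intro t _ v i
  obtain ⟨s, j, r, r'⟩ := (B.compile init rounds output).run port ident nodeIn edgeIn t v
  match j with
  | 0 => exact h₁ v s i
  | 1 => exact h₂ v s r i
  | j + 2 => exact h₃ v s r r' i

end BlockAlgorithm

theorem PortNumbering.rev_rev {V : Type*} [Fintype V] {G : SimpleGraph V} [DecidableRel G.Adj]
    (port : PortNumbering G) (e : Σ v, Fin (G.degree v)) : port.rev (port.rev e) = e := by
  -- The node is generalized to a variable `w` with `w = v`, since the type of the port depends on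
  -- the node.
  have key : ∀ (v w : V) (i : Fin (G.degree v)), w = v → ∀ (h : G.Adj w (port.nbr v i)),
      (⟨w, (port w).symm ⟨port.nbr v i, h⟩⟩ : Σ v, Fin (G.degree v)) = ⟨v, i⟩ := by
    rintro v w i rfl h
    have : (⟨port.nbr w i, h⟩ : G.neighborSet w) = port w i := rfl
    rw [this, Equiv.symm_apply_apply]
  obtain ⟨v, i⟩ := e
  have h1 : port.nbr (port.nbr v i) (port.back v i) = v := by
    exact congrArg Subtype.val (Equiv.apply_symm_apply _ _)
  have h2 : ∀ (x : V) (hx : x = v) (h : G.Adj (port.nbr v i) x),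
      (⟨x, (port x).symm ⟨port.nbr v i, h.symm⟩⟩ : Σ v, Fin (G.degree v)) = ⟨v, i⟩ :=
    fun x hx h => key v x i hx h.symm
  exact h2 _ h1 (port.adj_nbr _ _)

/-! ## The balancing algorithm -/

open scoped Classical in
/-- Some `k` elements of `s`, or all of them if there are fewer. -/
noncomputable def pick {ι : Type*} (k : ℕ) (s : Finset ι) : Finset ι :=
  if h : k ≤ s.card then (Finset.exists_subset_card_eq h).choose else s

theorem pick_subset {ι : Type*} (k : ℕ) (s : Finset ι) : pick k s ⊆ s := by
  unfold pick
  split_ifs with h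
  · exact (Finset.exists_subset_card_eq h).choose_spec.1
  · exact subset_rfl

theorem card_pick_le {ι : Type*} (k : ℕ) (s : Finset ι) : (pick k s).card ≤ k := by
  unfold pick
  split_ifs with h
  · exact (Finset.exists_subset_card_eq h).choose_spec.2.le
  · omega

/-- An element is left out only when the quota is exhausted. Every count of refused proposals,
withheld offers and declined tokens rests on this. -/
theorem le_card_pick {ι : Type*} {k : ℕ} {s : Finset ι} {i : ι} (hi : i ∈ s) (hi' : i ∉ pick k s) :
    k ≤ (pick k s).card := by
  unfold pick at hi' ⊢
  split_ifs with h
  · exact (Finset.exists_subset_card_eq h).choose_spec.2.ge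
  · rw [dif_neg h] at hi'
    exact (hi' hi).elim

/-- The parameters of the balancing algorithm.  In phase `i` a node accepts at most `cap i` edges,
among those whose endpoints have degree sum at least `scale * cap i - scale`; a phase has `rounds`
rounds of token dropping.  `threshold` is the number of red edges at the endpoints of an edge at
which the preferred color of the edge changes, as a function of the parameter of the edge and of
the degree sum of its endpoints. -/
structure BalancingParams where
  ratio : ℕ
  rounds : ℕ
  scale : ℕ
  cap : ℕ → ℕ
  threshold : ℝ → ℕ → ℝ

namespace BalancingParams

variable (P : BalancingParams)

/-- The tolerated difference between the numbers of edges oriented towards a node of degree `d` and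
towards its neighbor of degree `d'`, for an edge oriented towards the node. -/
noncomputable def bias (side : Bool) (lam : ℝ) (d d' : ℕ) : ℝ :=
  if side then P.threshold lam (d + d') - d' else d - P.threshold lam (d + d')

/-- Seen from its two ends, an edge has opposite biases as well as opposite differences, so "above
the bias" at one end means "below" at the other. -/
theorem bias_not (side : Bool) (lam : ℝ) (d d' : ℕ) :
    P.bias (!side) lam d' d = - P.bias side lam d d' := by
  cases side <;> simp [bias, add_comm d' d]

/-- Edges whose endpoints have degree sum `D` take part in phase `i`. -/
def Eligible (i D : ℕ) : Prop := P.scale * P.cap i ≤ D + P.scale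

/-- The number of tokens that a node of degree `d` handles in a round. -/
def bandwidth (d : ℕ) : ℕ := d / P.ratio + 1

/-- The number of tokens that a donor retires in a round of phase `i`. -/
def retire (i : ℕ) : ℕ := P.cap i / P.rounds + 1

end BalancingParams

/-- The state of a node: `towards` and `away` are the ports of the edges oriented towards and away
from the node; `out` and `inn` are the ports through which a token may leave and enter in the
current phase; `base` is the number of edges oriented towards the node at the start of the phase. -/
structure BalancingState (d : ℕ) where
  par : BalancingParams
  side : Bool
  lam : Fin d → ℝ
  time : ℕ
  towards : Finset (Fin d)
  away : Finset (Fin d)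
  out : Finset (Fin d)
  inn : Finset (Fin d)
  base : ℕ
  retired : ℕ

namespace BalancingState

variable {d : ℕ} (s : BalancingState d)

def phase : ℕ := s.time / (s.par.rounds + 1)

def IsSetup : Prop := s.time % (s.par.rounds + 1) = 0

def Donor : Prop :=
  IsDonor (s.par.retire s.phase) (s.par.bandwidth d) s.base s.towards.card s.retired

def Receiver : Prop :=
  IsReceiver (s.par.cap s.phase) (s.par.retire s.phase) (s.par.bandwidth d) s.base s.towards.card
    s.retired

noncomputable def bias (r₁ : Fin d → ℕ) (i : Fin d) : ℝ := s.par.bias s.side (s.lam i) d (r₁ i)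

noncomputable def diff (r₂ : Fin d → ℕ) (i : Fin d) : ℝ := (s.towards.card : ℝ) - r₂ i

open scoped Classical in
/-- The ports of the undecided edges that propose to be oriented towards the node. -/
noncomputable def proposals (r₁ r₂ : Fin d → ℕ) : Finset (Fin d) :=
  {i | (i ∉ s.towards ∧ i ∉ s.away) ∧ s.par.Eligible s.phase (d + r₁ i) ∧
    (if s.side then s.diff r₂ i ≤ s.bias r₁ i else s.diff r₂ i < s.bias r₁ i)}

noncomputable def adopted (r₁ r₂ : Fin d → ℕ) : Finset (Fin d) :=
  pick (s.par.cap s.phase) (s.proposals r₁ r₂)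

open scoped Classical in
noncomputable def offers (r₁ : Fin d → ℕ) : Finset (Fin d) :=
  if s.Donor then pick (s.par.bandwidth d) {i ∈ s.out | r₁ i = 1} else ∅

/-- The ports on which the message `1` has been received. -/
def granted (r : Fin d → ℕ) : Finset (Fin d) := {i | r i = 1}

noncomputable def accepted (r₂ : Fin d → ℕ) : Finset (Fin d) :=
  pick (s.par.bandwidth d) (granted r₂)

/-- Only edges oriented before the phase whose difference reaches the bias may be flipped; the
reversed edge then respects the bias with the counts of the phase start. Newly adopted edges stay
fixed throughout the phase, and `base` does not count them. -/
noncomputable def afterSetup (r₁ r₂ r₃ : Fin d → ℕ) : BalancingState d :=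
  { s with
    time := s.time + 1
    towards := s.towards ∪ s.adopted r₁ r₂
    away := s.away ∪ granted r₃
    out := {i ∈ s.towards | s.bias r₁ i ≤ s.diff r₂ i}
    inn := {i ∈ s.away | s.diff r₂ i ≤ s.bias r₁ i}
    base := s.towards.card
    retired := 0 }

open scoped Classical in
noncomputable def newlyRetired : ℕ := if s.Donor then s.par.retire s.phase else 0

/-- Accepted ports are not added to `out`, so an edge is flipped at most once per phase. -/
noncomputable def afterRound (r₂ r₃ : Fin d → ℕ) : BalancingState d :=
  { s with
    time := s.time + 1
    towards := (s.towards \ granted r₃) ∪ s.accepted r₂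
    away := (s.away \ s.accepted r₂) ∪ granted r₃
    out := s.out \ granted r₃
    inn := s.inn \ s.accepted r₂
    retired := s.retired + s.newlyRetired }

end BalancingState

open scoped Classical in
/-- The algorithm that orients all edges in a balanced way. -/
noncomputable def balancing : BlockAlgorithm BalancingState where
  msg₁ {d} s _ := if s.IsSetup then d else if s.Receiver then 1 else 0
  msg₂ s r₁ i := if s.IsSetup then s.towards.card else if i ∈ s.offers r₁ then 1 else 0
  msg₃ s r₁ r₂ i :=
    if i ∈ (if s.IsSetup then s.adopted r₁ r₂ else s.accepted r₂) then 1 else 0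
  next s r₁ r₂ r₃ := if s.IsSetup then s.afterSetup r₁ r₂ r₃ else s.afterRound r₂ r₃

/-! ### Consistency of the states at the two ends of an edge -/

section Dynamics

variable {V : Type*} {deg : V → ℕ} {rev : (Σ v, Fin (deg v)) → Σ v, Fin (deg v)}

/-- The degree sum of the endpoints of an edge. -/
def degSum (rev : (Σ v, Fin (deg v)) → Σ v, Fin (deg v)) (e : Σ v, Fin (deg v)) : ℕ :=
  deg e.1 + deg (rev e).1

/-- The states of the nodes at time `t` are compatible with each other. -/
structure Compatible (rev : (Σ v, Fin (deg v)) → Σ v, Fin (deg v)) (P : BalancingParams)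
    (side : V → Bool) (lam : (Σ v, Fin (deg v)) → ℝ) (t : ℕ)
    (s : ∀ v, BalancingState (deg v)) : Prop where
  par_eq : ∀ v, (s v).par = P
  time_eq : ∀ v, (s v).time = t
  side_eq : ∀ v, (s v).side = side v
  lam_eq : ∀ v i, (s v).lam i = lam ⟨v, i⟩
  mem_away : ∀ e : Σ v, Fin (deg v), e.2 ∈ (s e.1).away ↔ (rev e).2 ∈ (s (rev e).1).towards
  notMem_away : ∀ e : Σ v, Fin (deg v), e.2 ∈ (s e.1).towards → e.2 ∉ (s e.1).away
  mem_inn : ∀ e : Σ v, Fin (deg v), e.2 ∈ (s e.1).inn ↔ (rev e).2 ∈ (s (rev e).1).out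
  out_sub : ∀ v, (s v).out ⊆ (s v).towards

/-- The tolerated difference at a dart. -/
noncomputable def dartBias (rev : (Σ v, Fin (deg v)) → Σ v, Fin (deg v)) (P : BalancingParams)
    (side : V → Bool) (lam : (Σ v, Fin (deg v)) → ℝ) (e : Σ v, Fin (deg v)) : ℝ :=
  P.bias (side e.1) (lam e) (deg e.1) (deg (rev e).1)

/-- The difference at a dart. -/
noncomputable def dartDiff (rev : (Σ v, Fin (deg v)) → Σ v, Fin (deg v))
    (s : ∀ v, BalancingState (deg v)) (e : Σ v, Fin (deg v)) : ℝ :=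
  ((s e.1).towards.card : ℝ) - (s (rev e).1).towards.card

variable {P : BalancingParams} {side : V → Bool} {lam : (Σ v, Fin (deg v)) → ℝ} {t : ℕ}
  {s : ∀ v, BalancingState (deg v)}

theorem dartBias_rev (hrev : ∀ e, rev (rev e) = e) (hside : ∀ e, side (rev e).1 = !side e.1)
    (hlam : ∀ e, lam (rev e) = lam e) (e : Σ v, Fin (deg v)) :
    dartBias rev P side lam (rev e) = - dartBias rev P side lam e := by
  unfold dartBias
  rw [hrev, hside, hlam, BalancingParams.bias_not]

theorem dartDiff_rev (hrev : ∀ e, rev (rev e) = e) (s : ∀ v, BalancingState (deg v))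
    (e : Σ v, Fin (deg v)) : dartDiff rev s (rev e) = - dartDiff rev s e := by
  unfold dartDiff
  rw [hrev]
  ring

theorem degSum_rev (hrev : ∀ e, rev (rev e) = e) (e : Σ v, Fin (deg v)) :
    degSum rev (rev e) = degSum rev e := by
  unfold degSum
  rw [hrev, add_comm]

namespace Compatible

theorem mem_away_rev (h : Compatible rev P side lam t s) (hrev : ∀ e, rev (rev e) = e)
    (e : Σ v, Fin (deg v)) : (rev e).2 ∈ (s (rev e).1).away ↔ e.2 ∈ (s e.1).towards := by
  have := h.mem_away (rev e)
  rwa [hrev] at this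

theorem isSetup_iff (h : Compatible rev P side lam t s) (v : V) :
    (s v).IsSetup ↔ t % (P.rounds + 1) = 0 := by
  rw [BalancingState.IsSetup, h.par_eq, h.time_eq]

theorem phase_eq (h : Compatible rev P side lam t s) (v : V) :
    (s v).phase = t / (P.rounds + 1) := by
  rw [BalancingState.phase, h.par_eq, h.time_eq]

end Compatible

end Dynamics

/-! ### The setup block -/

section Setup

variable {V : Type*} {deg : V → ℕ} {rev : (Σ v, Fin (deg v)) → Σ v, Fin (deg v)}
  {P : BalancingParams} {side : V → Bool} {lam : (Σ v, Fin (deg v)) → ℝ} {t : ℕ}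
  {s : ∀ v, BalancingState (deg v)}

/-- The ports of the edges that get oriented towards a node in a setup block. -/
noncomputable def adoptedAt (rev : (Σ v, Fin (deg v)) → Σ v, Fin (deg v))
    (s : ∀ v, BalancingState (deg v)) (v : V) : Finset (Fin (deg v)) :=
  (s v).adopted (balancing.in₁ rev s v) (balancing.in₂ rev s v)

namespace Compatible

theorem in₁_setup (h : Compatible rev P side lam t s) (ht : t % (P.rounds + 1) = 0) (v : V)
    (i : Fin (deg v)) : balancing.in₁ rev s v i = deg (rev ⟨v, i⟩).1 := by
  simp [BlockAlgorithm.in₁, balancing, h.isSetup_iff, ht]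

theorem in₂_setup (h : Compatible rev P side lam t s) (ht : t % (P.rounds + 1) = 0) (v : V)
    (i : Fin (deg v)) : balancing.in₂ rev s v i = (s (rev ⟨v, i⟩).1).towards.card := by
  simp [BlockAlgorithm.in₂, balancing, h.isSetup_iff, ht]

theorem in₃_setup (h : Compatible rev P side lam t s) (ht : t % (P.rounds + 1) = 0)
    (e : Σ v, Fin (deg v)) :
    balancing.in₃ rev s e.1 e.2 = 1 ↔ (rev e).2 ∈ adoptedAt rev s (rev e).1 := by
  simp [BlockAlgorithm.in₃, balancing, h.isSetup_iff, ht, adoptedAt]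

theorem bias_setup (h : Compatible rev P side lam t s) (ht : t % (P.rounds + 1) = 0)
    (e : Σ v, Fin (deg v)) :
    (s e.1).bias (balancing.in₁ rev s e.1) e.2 = dartBias rev P side lam e := by
  rw [BalancingState.bias, h.par_eq, h.side_eq, h.lam_eq, h.in₁_setup ht]
  rfl

theorem diff_setup (h : Compatible rev P side lam t s) (ht : t % (P.rounds + 1) = 0)
    (e : Σ v, Fin (deg v)) :
    (s e.1).diff (balancing.in₂ rev s e.1) e.2 = dartDiff rev s e := by
  rw [BalancingState.diff, h.in₂_setup ht]
  rfl

theorem mem_proposals (h : Compatible rev P side lam t s) (ht : t % (P.rounds + 1) = 0)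
    (e : Σ v, Fin (deg v)) :
    e.2 ∈ (s e.1).proposals (balancing.in₁ rev s e.1) (balancing.in₂ rev s e.1) ↔
      (e.2 ∉ (s e.1).towards ∧ e.2 ∉ (s e.1).away) ∧
        P.Eligible (t / (P.rounds + 1)) (degSum rev e) ∧
        (if side e.1 then dartDiff rev s e ≤ dartBias rev P side lam e
          else dartDiff rev s e < dartBias rev P side lam e) := by
  simp only [BalancingState.proposals, Finset.mem_filter, Finset.mem_univ, true_and,
    h.bias_setup ht, h.diff_setup ht, h.in₁_setup ht, h.phase_eq, h.par_eq, h.side_eq]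
  rfl

theorem mem_proposals_of_mem (h : Compatible rev P side lam t s) (ht : t % (P.rounds + 1) = 0)
    {e : Σ v, Fin (deg v)} (he : e.2 ∈ adoptedAt rev s e.1) :
    (e.2 ∉ (s e.1).towards ∧ e.2 ∉ (s e.1).away) ∧
        P.Eligible (t / (P.rounds + 1)) (degSum rev e) ∧
        (if side e.1 then dartDiff rev s e ≤ dartBias rev P side lam e
          else dartDiff rev s e < dartBias rev P side lam e) :=
  (h.mem_proposals ht e).1 (pick_subset _ _ he)

theorem card_adoptedAt_le (h : Compatible rev P side lam t s) (v : V) :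
    (adoptedAt rev s v).card ≤ P.cap (t / (P.rounds + 1)) := by
  refine (card_pick_le _ _).trans ?_
  rw [h.phase_eq, h.par_eq]

theorem step_setup (h : Compatible rev P side lam t s) (ht : t % (P.rounds + 1) = 0) (v : V) :
    balancing.step rev s v = (s v).afterSetup (balancing.in₁ rev s v) (balancing.in₂ rev s v)
      (balancing.in₃ rev s v) :=
  if_pos ((h.isSetup_iff v).2 ht)

theorem towards_step_setup (h : Compatible rev P side lam t s) (ht : t % (P.rounds + 1) = 0)
    (v : V) : (balancing.step rev s v).towards = (s v).towards ∪ adoptedAt rev s v := by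
  rw [h.step_setup ht]
  rfl

theorem mem_away_step_setup (h : Compatible rev P side lam t s) (ht : t % (P.rounds + 1) = 0)
    (e : Σ v, Fin (deg v)) : e.2 ∈ (balancing.step rev s e.1).away ↔
      e.2 ∈ (s e.1).away ∨ (rev e).2 ∈ adoptedAt rev s (rev e).1 := by
  rw [← h.in₃_setup ht, h.step_setup ht]
  simp [BalancingState.afterSetup, BalancingState.granted]

theorem mem_out_step_setup (h : Compatible rev P side lam t s) (ht : t % (P.rounds + 1) = 0)
    (e : Σ v, Fin (deg v)) : e.2 ∈ (balancing.step rev s e.1).out ↔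
      e.2 ∈ (s e.1).towards ∧ dartBias rev P side lam e ≤ dartDiff rev s e := by
  rw [← h.bias_setup ht, ← h.diff_setup ht, h.step_setup ht]
  simp [BalancingState.afterSetup]

theorem mem_inn_step_setup (h : Compatible rev P side lam t s) (ht : t % (P.rounds + 1) = 0)
    (e : Σ v, Fin (deg v)) : e.2 ∈ (balancing.step rev s e.1).inn ↔
      e.2 ∈ (s e.1).away ∧ dartDiff rev s e ≤ dartBias rev P side lam e := by
  rw [← h.bias_setup ht, ← h.diff_setup ht, h.step_setup ht]
  simp [BalancingState.afterSetup]

theorem compatible_step_setup (h : Compatible rev P side lam t s)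
    (ht : t % (P.rounds + 1) = 0) (hrev : ∀ e, rev (rev e) = e)
    (hside : ∀ e, side (rev e).1 = !side e.1) (hlam : ∀ e, lam (rev e) = lam e) :
    Compatible rev P side lam (t + 1) (balancing.step rev s) where
  par_eq v := by rw [h.step_setup ht]; exact h.par_eq v
  time_eq v := by rw [h.step_setup ht]; exact congrArg (· + 1) (h.time_eq v)
  side_eq v := by rw [h.step_setup ht]; exact h.side_eq v
  lam_eq v i := by rw [h.step_setup ht]; exact h.lam_eq v i
  mem_away e := by
    rw [h.mem_away_step_setup ht, h.towards_step_setup ht, Finset.mem_union, h.mem_away]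
  notMem_away e := by
    rw [h.mem_away_step_setup ht, h.towards_step_setup ht, Finset.mem_union]
    rintro (h1 | h1) (h2 | h2)
    · exact h.notMem_away e h1 h2
    · have h3 := (h.mem_proposals_of_mem ht h2).1.2
      rw [h.mem_away_rev hrev] at h3
      exact h3 h1
    · exact (h.mem_proposals_of_mem ht h1).1.2 h2
    -- No edge is adopted at both ends: differences and biases are negated, and the strict
    -- inequality required on one side excludes the weak one required on the other.
    · have h3 := (h.mem_proposals_of_mem ht h1).2.2
      have h4 := (h.mem_proposals_of_mem ht h2).2.2
      rw [hside, dartBias_rev hrev hside hlam, dartDiff_rev hrev] at h4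
      cases hs : side e.1 <;> simp only [hs, Bool.not_true, Bool.not_false, if_true,
        Bool.false_eq_true, if_false] at h3 h4 <;> linarith
  mem_inn e := by
    rw [h.mem_inn_step_setup ht, h.mem_out_step_setup ht, h.mem_away,
      dartBias_rev hrev hside hlam, dartDiff_rev hrev, neg_le_neg_iff]
  out_sub v := by
    intro i hi
    have := (h.mem_out_step_setup ht ⟨v, i⟩).1 hi
    rw [h.towards_step_setup ht]
    exact Finset.mem_union_left _ this.1

/-- The number of decided edges at a node. -/
def _root_.decided {d : ℕ} (s : BalancingState d) : ℕ := (s.towards ∪ s.away).card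

theorem decided_step_setup (h : Compatible rev P side lam t s)
    (ht : t % (P.rounds + 1) = 0) (v : V) :
    decided (s v) ≤ decided (balancing.step rev s v) ∧
    decided (s v) + (adoptedAt rev s v).card ≤ decided (balancing.step rev s v) := by
  suffices decided (s v) + (adoptedAt rev s v).card ≤ decided (balancing.step rev s v) from
    ⟨by omega, this⟩
  unfold decided
  rw [← Finset.card_union_of_disjoint]
  · refine Finset.card_le_card ?_
    intro i hi
    have := h.mem_away_step_setup ht ⟨v, i⟩
    simp only [Finset.mem_union, h.towards_step_setup ht] at hi ⊢
    tauto
  · rw [Finset.disjoint_left]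
    intro i hi hi'
    have := (h.mem_proposals_of_mem ht (e := ⟨v, i⟩) hi').1
    simp only [Finset.mem_union] at hi
    tauto

/-- An eligible edge that stays undecided makes many other edges decided. -/
theorem progress_setup (h : Compatible rev P side lam t s) (ht : t % (P.rounds + 1) = 0)
    (hrev : ∀ e, rev (rev e) = e)
    (hside : ∀ e, side (rev e).1 = !side e.1) (hlam : ∀ e, lam (rev e) = lam e)
    {e : Σ v, Fin (deg v)} (he : P.Eligible (t / (P.rounds + 1)) (degSum rev e))
    (h1 : e.2 ∉ (balancing.step rev s e.1).towards)
    (h2 : e.2 ∉ (balancing.step rev s e.1).away) :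
    decided (s e.1) + decided (s (rev e).1) + P.cap (t / (P.rounds + 1)) ≤
      decided (balancing.step rev s e.1) + decided (balancing.step rev s (rev e).1) := by
  rw [h.mem_away_step_setup ht, not_or] at h2
  rw [h.towards_step_setup ht, Finset.mem_union, not_or] at h1
  have hd1 := h.decided_step_setup ht e.1
  have hd2 := h.decided_step_setup ht (rev e).1
  have key : ∀ f : Σ v, Fin (deg v),
      f.2 ∈ (s f.1).proposals (balancing.in₁ rev s f.1) (balancing.in₂ rev s f.1) →
      f.2 ∉ adoptedAt rev s f.1 → P.cap (t / (P.rounds + 1)) ≤ (adoptedAt rev s f.1).card := by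
    intro f hf hf'
    rw [← h.phase_eq f.1, ← h.par_eq f.1]
    exact le_card_pick hf hf'
  -- The tie-breaking rule makes the edge propose to one of its ends. That end did not adopt it and
  -- has therefore adopted `cap` other edges.
  by_cases hp : e.2 ∈ (s e.1).proposals (balancing.in₁ rev s e.1) (balancing.in₂ rev s e.1)
  · have := key e hp h1.2
    omega
  · have hq : (rev e).2 ∈ (s (rev e).1).proposals (balancing.in₁ rev s (rev e).1)
        (balancing.in₂ rev s (rev e).1) := by
      rw [h.mem_proposals ht, degSum_rev hrev, hside, dartBias_rev hrev hside hlam,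
        dartDiff_rev hrev, h.mem_away_rev hrev, ← h.mem_away]
      rw [h.mem_proposals ht] at hp
      refine ⟨⟨h2.1, h1.1⟩, he, ?_⟩
      have h3 : ¬ _ := fun h3 => hp ⟨⟨h1.1, h2.1⟩, he, h3⟩
      cases hs : side e.1 <;> simp only [hs, Bool.not_true, Bool.not_false, if_true,
        Bool.false_eq_true, if_false] at h3 ⊢ <;> linarith
    have := key (rev e) hq h2.2
    omega

end Compatible

end Setup

/-! ### Token dropping blocks -/

section Round

variable {V : Type*} {deg : V → ℕ} {rev : (Σ v, Fin (deg v)) → Σ v, Fin (deg v)}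
  {P : BalancingParams} {side : V → Bool} {lam : (Σ v, Fin (deg v)) → ℝ} {t : ℕ}
  {s : ∀ v, BalancingState (deg v)}

/-- The ports on which a node offers a token. -/
noncomputable def offersAt (rev : (Σ v, Fin (deg v)) → Σ v, Fin (deg v))
    (s : ∀ v, BalancingState (deg v)) (v : V) : Finset (Fin (deg v)) :=
  (s v).offers (balancing.in₁ rev s v)

/-- The ports through which a node accepts a token. -/
noncomputable def acceptedAt (rev : (Σ v, Fin (deg v)) → Σ v, Fin (deg v))
    (s : ∀ v, BalancingState (deg v)) (v : V) : Finset (Fin (deg v)) :=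
  (s v).accepted (balancing.in₂ rev s v)

/-- The ports through which a node loses a token. -/
noncomputable def flippedAt (rev : (Σ v, Fin (deg v)) → Σ v, Fin (deg v))
    (s : ∀ v, BalancingState (deg v)) (v : V) : Finset (Fin (deg v)) :=
  BalancingState.granted (balancing.in₃ rev s v)

namespace Compatible

theorem in₁_round (h : Compatible rev P side lam t s) (ht : t % (P.rounds + 1) ≠ 0)
    (e : Σ v, Fin (deg v)) : balancing.in₁ rev s e.1 e.2 = 1 ↔ (s (rev e).1).Receiver := by
  simp [BlockAlgorithm.in₁, balancing, h.isSetup_iff, ht]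

theorem in₂_round (h : Compatible rev P side lam t s) (ht : t % (P.rounds + 1) ≠ 0)
    (e : Σ v, Fin (deg v)) :
    balancing.in₂ rev s e.1 e.2 = 1 ↔ (rev e).2 ∈ offersAt rev s (rev e).1 := by
  simp [BlockAlgorithm.in₂, balancing, h.isSetup_iff, ht, offersAt]

theorem mem_flippedAt (h : Compatible rev P side lam t s) (ht : t % (P.rounds + 1) ≠ 0)
    (e : Σ v, Fin (deg v)) :
    e.2 ∈ flippedAt rev s e.1 ↔ (rev e).2 ∈ acceptedAt rev s (rev e).1 := by
  simp [flippedAt, BalancingState.granted, BlockAlgorithm.in₃, balancing, h.isSetup_iff, ht,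
    acceptedAt]

theorem mem_offersAt (h : Compatible rev P side lam t s) (ht : t % (P.rounds + 1) ≠ 0)
    {e : Σ v, Fin (deg v)} (he : e.2 ∈ offersAt rev s e.1) :
    e.2 ∈ (s e.1).out ∧ (s e.1).Donor ∧ (s (rev e).1).Receiver := by
  unfold offersAt BalancingState.offers at he
  split_ifs at he with hd
  · have := pick_subset _ _ he
    rw [Finset.mem_filter, h.in₁_round ht] at this
    exact ⟨this.1, hd, this.2⟩
  · simp at he

theorem card_offersAt_le (h : Compatible rev P side lam t s) (v : V) :
    (offersAt rev s v).card ≤ P.bandwidth (deg v) := by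
  unfold offersAt BalancingState.offers
  split_ifs with hd
  · exact (card_pick_le _ _).trans (by rw [h.par_eq])
  · simp

theorem le_card_offersAt (h : Compatible rev P side lam t s) (ht : t % (P.rounds + 1) ≠ 0)
    {e : Σ v, Fin (deg v)} (h1 : e.2 ∈ (s e.1).out) (h2 : e.2 ∉ offersAt rev s e.1)
    (h3 : (s e.1).Donor) (h4 : (s (rev e).1).Receiver) :
    P.bandwidth (deg e.1) ≤ (offersAt rev s e.1).card := by
  unfold offersAt BalancingState.offers at h2 ⊢
  rw [if_pos h3] at h2 ⊢
  rw [← h.par_eq e.1]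
  exact le_card_pick (Finset.mem_filter.2 ⟨h1, (h.in₁_round ht e).2 h4⟩) h2

theorem mem_acceptedAt (h : Compatible rev P side lam t s) (ht : t % (P.rounds + 1) ≠ 0)
    {e : Σ v, Fin (deg v)} (he : e.2 ∈ acceptedAt rev s e.1) :
    (rev e).2 ∈ offersAt rev s (rev e).1 := by
  have := pick_subset _ _ he
  rwa [BalancingState.granted, Finset.mem_filter, h.in₂_round ht,
    and_iff_right (Finset.mem_univ _)] at this

theorem card_acceptedAt_le (h : Compatible rev P side lam t s) (v : V) :
    (acceptedAt rev s v).card ≤ P.bandwidth (deg v) :=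
  (card_pick_le _ _).trans (by rw [h.par_eq])

theorem le_card_acceptedAt (h : Compatible rev P side lam t s) (ht : t % (P.rounds + 1) ≠ 0)
    (hrev : ∀ e, rev (rev e) = e)
    {e : Σ v, Fin (deg v)} (h1 : e.2 ∈ offersAt rev s e.1)
    (h2 : (rev e).2 ∉ acceptedAt rev s (rev e).1) :
    P.bandwidth (deg (rev e).1) ≤ (acceptedAt rev s (rev e).1).card := by
  rw [← h.par_eq (rev e).1]
  refine le_card_pick (Finset.mem_filter.2 ⟨Finset.mem_univ _, ?_⟩) h2
  rw [h.in₂_round ht, hrev]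
  exact h1

theorem flippedAt_sub (h : Compatible rev P side lam t s) (ht : t % (P.rounds + 1) ≠ 0)
    (hrev : ∀ e, rev (rev e) = e) (v : V) : flippedAt rev s v ⊆ offersAt rev s v := by
  intro i hi
  have h1 := (h.mem_flippedAt ht ⟨v, i⟩).1 hi
  have h2 := h.mem_acceptedAt ht h1
  rwa [hrev] at h2

theorem acceptedAt_sub (h : Compatible rev P side lam t s) (ht : t % (P.rounds + 1) ≠ 0)
    (v : V) : acceptedAt rev s v ⊆ (s v).inn := by
  intro i hi
  rw [h.mem_inn ⟨v, i⟩]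
  exact (h.mem_offersAt ht (h.mem_acceptedAt ht (e := ⟨v, i⟩) hi)).1

theorem inn_sub (h : Compatible rev P side lam t s) (v : V) : (s v).inn ⊆ (s v).away := by
  intro i hi
  rw [h.mem_inn ⟨v, i⟩] at hi
  rw [h.mem_away ⟨v, i⟩]
  exact h.out_sub _ hi

theorem step_round (h : Compatible rev P side lam t s) (ht : t % (P.rounds + 1) ≠ 0) (v : V) :
    balancing.step rev s v =
      (s v).afterRound (balancing.in₂ rev s v) (balancing.in₃ rev s v) :=
  if_neg fun hs => ht ((h.isSetup_iff v).1 hs)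

theorem towards_step_round (h : Compatible rev P side lam t s) (ht : t % (P.rounds + 1) ≠ 0)
    (v : V) : (balancing.step rev s v).towards =
      ((s v).towards \ flippedAt rev s v) ∪ acceptedAt rev s v := by
  rw [h.step_round ht]
  rfl

theorem away_step_round (h : Compatible rev P side lam t s) (ht : t % (P.rounds + 1) ≠ 0)
    (v : V) : (balancing.step rev s v).away =
      ((s v).away \ acceptedAt rev s v) ∪ flippedAt rev s v := by
  rw [h.step_round ht]
  rfl

theorem out_step_round (h : Compatible rev P side lam t s) (ht : t % (P.rounds + 1) ≠ 0)
    (v : V) : (balancing.step rev s v).out = (s v).out \ flippedAt rev s v := by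
  rw [h.step_round ht]
  rfl

theorem inn_step_round (h : Compatible rev P side lam t s) (ht : t % (P.rounds + 1) ≠ 0)
    (v : V) : (balancing.step rev s v).inn = (s v).inn \ acceptedAt rev s v := by
  rw [h.step_round ht]
  rfl

theorem compatible_step_round (h : Compatible rev P side lam t s)
    (ht : t % (P.rounds + 1) ≠ 0) (hrev : ∀ e, rev (rev e) = e) :
    Compatible rev P side lam (t + 1) (balancing.step rev s) where
  par_eq v := by rw [h.step_round ht]; exact h.par_eq v
  side_eq v := by rw [h.step_round ht]; exact h.side_eq v
  lam_eq v i := by rw [h.step_round ht]; exact h.lam_eq v i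
  time_eq v := by rw [h.step_round ht]; exact congrArg (· + 1) (h.time_eq v)
  mem_away e := by
    have h1 := h.mem_flippedAt ht (rev e)
    rw [hrev] at h1
    rw [h.towards_step_round ht, h.away_step_round ht]
    simp only [Finset.mem_union, Finset.mem_sdiff]
    rw [h.mem_away, h.mem_flippedAt ht, h1]
  notMem_away e := by
    rw [h.towards_step_round ht, h.away_step_round ht]
    simp only [Finset.mem_union, Finset.mem_sdiff]
    have h1 := h.notMem_away e
    have h2 : e.2 ∈ flippedAt rev s e.1 → e.2 ∈ (s e.1).towards := fun h2 =>
      h.out_sub _ (h.mem_offersAt ht (h.flippedAt_sub ht hrev _ h2)).1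
    have h3 : e.2 ∈ acceptedAt rev s e.1 → e.2 ∈ (s e.1).away := fun h3 =>
      h.inn_sub _ (h.acceptedAt_sub ht _ h3)
    tauto
  mem_inn e := by
    have h1 := h.mem_flippedAt ht (rev e)
    rw [hrev] at h1
    rw [h.out_step_round ht, h.inn_step_round ht]
    simp only [Finset.mem_sdiff]
    rw [h.mem_inn, h1]
  out_sub v := by
    rw [h.out_step_round ht, h.towards_step_round ht]
    exact (Finset.sdiff_subset_sdiff (h.out_sub v) subset_rfl).trans Finset.subset_union_left

theorem card_towards_step_round (h : Compatible rev P side lam t s)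
    (ht : t % (P.rounds + 1) ≠ 0) (hrev : ∀ e, rev (rev e) = e) (v : V) :
    (balancing.step rev s v).towards.card + (flippedAt rev s v).card =
      (s v).towards.card + (acceptedAt rev s v).card := by
  have h1 : flippedAt rev s v ⊆ (s v).towards := fun i hi =>
    h.out_sub _ (h.mem_offersAt ht (e := ⟨v, i⟩) (h.flippedAt_sub ht hrev _ hi)).1
  have h2 : Disjoint ((s v).towards \ flippedAt rev s v) (acceptedAt rev s v) := by
    rw [Finset.disjoint_left]
    intro i hi hi'
    exact h.notMem_away ⟨v, i⟩ (Finset.mem_sdiff.1 hi).1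
      (h.inn_sub _ (h.acceptedAt_sub ht _ hi'))
  rw [h.towards_step_round ht, Finset.card_union_of_disjoint h2,
    Finset.card_sdiff_of_subset h1]
  have := Finset.card_le_card h1
  omega

/-- Token dropping only reverses edges that are already oriented; the set of decided edges changes
in setup blocks alone. -/
theorem towards_union_away_step_round (h : Compatible rev P side lam t s)
    (ht : t % (P.rounds + 1) ≠ 0) (hrev : ∀ e, rev (rev e) = e) (v : V) :
    (balancing.step rev s v).towards ∪ (balancing.step rev s v).away =
      (s v).towards ∪ (s v).away := by
  rw [h.towards_step_round ht, h.away_step_round ht]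
  ext i
  have h1 : i ∈ flippedAt rev s v → i ∈ (s v).towards := fun hi =>
    h.out_sub _ (h.mem_offersAt ht (e := ⟨v, i⟩) (h.flippedAt_sub ht hrev _ hi)).1
  have h2 : i ∈ acceptedAt rev s v → i ∈ (s v).away := fun hi =>
    h.inn_sub _ (h.acceptedAt_sub ht _ hi)
  simp only [Finset.mem_union, Finset.mem_sdiff]
  tauto

end Compatible

end Round

/-! ### Phases -/

section Phase

variable {V : Type*} {deg : V → ℕ} {rev : (Σ v, Fin (deg v)) → Σ v, Fin (deg v)}
  {P : BalancingParams} {side : V → Bool} {lam : (Σ v, Fin (deg v)) → ℝ} {t i : ℕ}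
  {s : ∀ v, BalancingState (deg v)}

/-- The states after the setup block of a phase and `t` token dropping blocks. -/
noncomputable def phaseState (rev : (Σ v, Fin (deg v)) → Σ v, Fin (deg v))
    (s : ∀ v, BalancingState (deg v)) (t : ℕ) : ∀ v, BalancingState (deg v) :=
  (balancing.step rev)^[t + 1] s

theorem phaseState_zero (s : ∀ v, BalancingState (deg v)) :
    phaseState rev s 0 = balancing.step rev s := rfl

theorem phaseState_succ (s : ∀ v, BalancingState (deg v)) (t : ℕ) :
    phaseState rev s (t + 1) = balancing.step rev (phaseState rev s t) :=
  Function.iterate_succ_apply' _ _ _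

theorem phase_time_mod (P : BalancingParams) (i : ℕ) {t : ℕ} (ht : t < P.rounds) :
    (i * (P.rounds + 1) + 1 + t) % (P.rounds + 1) ≠ 0 := by
  rw [show i * (P.rounds + 1) + 1 + t = (1 + t) + i * (P.rounds + 1) by ring,
    Nat.add_mul_mod_self_right, Nat.mod_eq_of_lt (by omega)]
  omega

theorem phase_time_div (P : BalancingParams) (i : ℕ) {t : ℕ} (ht : t < P.rounds) :
    (i * (P.rounds + 1) + 1 + t) / (P.rounds + 1) = i := by
  rw [show i * (P.rounds + 1) + 1 + t = (1 + t) + i * (P.rounds + 1) by ring,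
    Nat.add_mul_div_right _ _ (by omega), Nat.div_eq_of_lt (by omega), zero_add]

theorem phase_start_div (P : BalancingParams) (i : ℕ) :
    i * (P.rounds + 1) / (P.rounds + 1) = i :=
  Nat.mul_div_cancel _ (by omega)

namespace Compatible

theorem donor_iff (h : Compatible rev P side lam t s) (v : V) :
    (s v).Donor ↔ IsDonor (P.retire (t / (P.rounds + 1))) (P.bandwidth (deg v)) (s v).base
      (s v).towards.card (s v).retired := by
  rw [BalancingState.Donor, h.phase_eq, h.par_eq]

theorem receiver_iff (h : Compatible rev P side lam t s) (v : V) :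
    (s v).Receiver ↔ IsReceiver (P.cap (t / (P.rounds + 1))) (P.retire (t / (P.rounds + 1)))
      (P.bandwidth (deg v)) (s v).base (s v).towards.card (s v).retired := by
  rw [BalancingState.Receiver, h.phase_eq, h.par_eq]

theorem compatible_phaseState (h : Compatible rev P side lam (i * (P.rounds + 1)) s)
    (hrev : ∀ e, rev (rev e) = e) (hside : ∀ e, side (rev e).1 = !side e.1)
    (hlam : ∀ e, lam (rev e) = lam e) (ht : t ≤ P.rounds) :
    Compatible rev P side lam (i * (P.rounds + 1) + 1 + t) (phaseState rev s t) := by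
  induction t with
  | zero => exact h.compatible_step_setup (Nat.mul_mod_left _ _) hrev hside hlam
  | succ t ih =>
    rw [phaseState_succ]
    exact (ih (by omega)).compatible_step_round (phase_time_mod P i (by omega)) hrev

theorem base_phaseState (h : Compatible rev P side lam (i * (P.rounds + 1)) s)
    (hrev : ∀ e, rev (rev e) = e) (hside : ∀ e, side (rev e).1 = !side e.1)
    (hlam : ∀ e, lam (rev e) = lam e) (ht : t ≤ P.rounds) (v : V) :
    (phaseState rev s t v).base = (s v).towards.card := by
  induction t with
  | zero =>
    rw [phaseState_zero, h.step_setup (Nat.mul_mod_left _ _)]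
    rfl
  | succ t ih =>
    rw [phaseState_succ, (h.compatible_phaseState hrev hside hlam (by omega)).step_round
      (phase_time_mod P i (by omega)), ← ih (by omega)]
    rfl

/-- The tokens of a node are its edges in excess of the count at the start of the phase. The initial
tokens are the edges adopted in the setup block, hence at most `cap i`. -/
theorem tokenDropping (h : Compatible rev P side lam (i * (P.rounds + 1)) s)
    (hrev : ∀ e, rev (rev e) = e) (hside : ∀ e, side (rev e).1 = !side e.1)
    (hlam : ∀ e, lam (rev e) = lam e) (hratio : 0 < P.ratio) (hrounds : 0 < P.rounds) :
    TokenDropping rev P.ratio P.rounds (P.cap i) (P.retire i) (fun v => P.bandwidth (deg v))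
      (fun v => (s v).towards.card) (fun t v => (phaseState rev s t v).towards.card)
      (fun t v => (phaseState rev s t v).retired)
      (fun t v => (phaseState rev s t v).out)
      (fun t v => (phaseState rev s t v).inn)
      (fun t => offersAt rev (phaseState rev s t))
      (fun t => flippedAt rev (phaseState rev s t))
      (fun t => acceptedAt rev (phaseState rev s t)) := by
  have hmod : i * (P.rounds + 1) % (P.rounds + 1) = 0 := Nat.mul_mod_left _ _
  have hc : ∀ t ≤ P.rounds, Compatible rev P side lam (i * (P.rounds + 1) + 1 + t)
      (phaseState rev s t) := fun t ht => h.compatible_phaseState hrev hside hlam ht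
  have hm : ∀ t < P.rounds, (i * (P.rounds + 1) + 1 + t) % (P.rounds + 1) ≠ 0 :=
    fun t ht => phase_time_mod P i ht
  have hdon : ∀ t < P.rounds, ∀ v, (phaseState rev s t v).Donor ↔
      IsDonor (P.retire i) (P.bandwidth (deg v)) (s v).towards.card
        (phaseState rev s t v).towards.card (phaseState rev s t v).retired := by
    intro t ht v
    rw [(hc t ht.le).donor_iff, phase_time_div P i ht, h.base_phaseState hrev hside hlam ht.le]
  have hrec : ∀ t < P.rounds, ∀ v, (phaseState rev s t v).Receiver ↔
      IsReceiver (P.cap i) (P.retire i) (P.bandwidth (deg v)) (s v).towards.card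
        (phaseState rev s t v).towards.card (phaseState rev s t v).retired := by
    intro t ht v
    rw [(hc t ht.le).receiver_iff, phase_time_div P i ht,
      h.base_phaseState hrev hside hlam ht.le]
  have hret : ∀ t < P.rounds, ∀ v, (phaseState rev s (t + 1) v).retired =
      (phaseState rev s t v).retired + (phaseState rev s t v).newlyRetired := by
    intro t ht v
    rw [phaseState_succ, (hc t ht.le).step_round (hm t ht)]
    rfl
  exact
  { deg_le := fun v => by
      have := Nat.lt_mul_div_succ (deg v) hratio
      exact this.le
    alpha_pos := fun v => Nat.succ_pos _
    le_mul := by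
      have := Nat.lt_mul_div_succ (P.cap i) hrounds
      rw [mul_comm]
      exact this.le
    rev_rev := hrev
    p_zero := fun v => by
      rw [phaseState_zero, h.step_setup hmod]
      rfl
    le_cnt_zero := fun v => by
      rw [phaseState_zero, h.towards_step_setup hmod]
      exact Finset.card_le_card Finset.subset_union_left
    cnt_zero_le := fun v => by
      rw [phaseState_zero, h.towards_step_setup hmod]
      have := h.card_adoptedAt_le v
      rw [phase_start_div] at this
      exact (Finset.card_union_le _ _).trans (by omega)
    off_sub := fun t ht v j hj => ((hc t ht.le).mem_offersAt (hm t ht) (e := ⟨v, j⟩) hj).1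
    off_card := fun t ht v => (hc t ht.le).card_offersAt_le v
    off_donor := fun t ht v ⟨j, hj⟩ =>
      (hdon t ht v).1 ((hc t ht.le).mem_offersAt (hm t ht) (e := ⟨v, j⟩) hj).2.1
    off_receiver := fun t ht e he =>
      (hrec t ht _).1 ((hc t ht.le).mem_offersAt (hm t ht) he).2.2
    off_full := fun t ht e h1 h2 h3 h4 =>
      (hc t ht.le).le_card_offersAt (hm t ht) h1 h2 ((hdon t ht _).2 h3) ((hrec t ht _).2 h4)
    flip_sub := fun t ht v => (hc t ht.le).flippedAt_sub (hm t ht) hrev v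
    mem_flip := fun t ht e => (hc t ht.le).mem_flippedAt (hm t ht) e
    acc_sub := fun t ht v => (hc t ht.le).acceptedAt_sub (hm t ht) v
    acc_card := fun t ht v => (hc t ht.le).card_acceptedAt_le v
    acc_full := fun t ht e h1 h2 => (hc t ht.le).le_card_acceptedAt (hm t ht) hrev h1 h2
    out_succ := fun t ht v => by
      rw [phaseState_succ, (hc t ht.le).out_step_round (hm t ht)]
    inn_succ := fun t ht v => by
      rw [phaseState_succ, (hc t ht.le).inn_step_round (hm t ht)]
    cnt_succ := fun t ht v => by
      rw [phaseState_succ]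
      exact (hc t ht.le).card_towards_step_round (hm t ht) hrev v
    p_succ_donor := fun t ht v hd => by
      rw [hret t ht, BalancingState.newlyRetired, if_pos ((hdon t ht v).2 hd),
        (hc t ht.le).par_eq, (hc t ht.le).phase_eq, phase_time_div P i ht]
    p_succ := fun t ht v hd => by
      rw [hret t ht, BalancingState.newlyRetired, if_neg (mt (hdon t ht v).1 hd), add_zero] }

theorem union_phaseState (h : Compatible rev P side lam (i * (P.rounds + 1)) s)
    (hrev : ∀ e, rev (rev e) = e) (hside : ∀ e, side (rev e).1 = !side e.1)
    (hlam : ∀ e, lam (rev e) = lam e) (ht : t ≤ P.rounds) (v : V) :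
    (phaseState rev s t v).towards ∪ (phaseState rev s t v).away =
      (balancing.step rev s v).towards ∪ (balancing.step rev s v).away := by
  induction t with
  | zero => rfl
  | succ t ih =>
    have hc := h.compatible_phaseState hrev hside hlam (show t ≤ P.rounds by omega)
    rw [phaseState_succ, hc.towards_union_away_step_round (phase_time_mod P i (by omega)) hrev, ih (by omega)]

theorem of_mem_out_phaseState (h : Compatible rev P side lam (i * (P.rounds + 1)) s)
    (hrev : ∀ e, rev (rev e) = e) (hside : ∀ e, side (rev e).1 = !side e.1)
    (hlam : ∀ e, lam (rev e) = lam e) (ht : t ≤ P.rounds) (e : Σ v, Fin (deg v))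
    (he : e.2 ∈ (phaseState rev s t e.1).out) :
    e.2 ∈ (s e.1).towards ∧ dartBias rev P side lam e ≤ dartDiff rev s e := by
  induction t with
  | zero => exact (h.mem_out_step_setup (Nat.mul_mod_left _ _) e).1 he
  | succ t ih =>
    rw [phaseState_succ, (h.compatible_phaseState hrev hside hlam (by omega)).out_step_round
      (phase_time_mod P i (by omega)), Finset.mem_sdiff] at he
    exact ih (by omega) he.1

/-- An oriented edge outside `out` was below the bias at the start of the phase, was just adopted,
or has been reversed by a flip. In each case its present direction respects the bias with the old
counts. -/
theorem of_mem_towards_phaseState (h : Compatible rev P side lam (i * (P.rounds + 1)) s)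
    (hrev : ∀ e, rev (rev e) = e) (hside : ∀ e, side (rev e).1 = !side e.1)
    (hlam : ∀ e, lam (rev e) = lam e) (ht : t ≤ P.rounds) (e : Σ v, Fin (deg v))
    (he : e.2 ∈ (phaseState rev s t e.1).towards) :
    e.2 ∈ (phaseState rev s t e.1).out ∨
      dartDiff rev s e ≤ dartBias rev P side lam e := by
  induction t with
  | zero =>
    have hmod : i * (P.rounds + 1) % (P.rounds + 1) = 0 := Nat.mul_mod_left _ _
    rw [phaseState_zero, h.towards_step_setup hmod, Finset.mem_union] at he
    rw [phaseState_zero, h.mem_out_step_setup hmod]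
    rcases he with he | he
    · rcases le_total (dartBias rev P side lam e) (dartDiff rev s e) with h1 | h1
      · exact Or.inl ⟨he, h1⟩
      · exact Or.inr h1
    · right
      have := (h.mem_proposals_of_mem hmod he).2.2
      split_ifs at this
      · exact this
      · exact this.le
  | succ t ih =>
    have hc := h.compatible_phaseState hrev hside hlam (show t ≤ P.rounds by omega)
    have hm := phase_time_mod P i (show t < P.rounds by omega)
    rw [phaseState_succ, hc.towards_step_round hm, Finset.mem_union, Finset.mem_sdiff] at he
    rw [phaseState_succ, hc.out_step_round hm, Finset.mem_sdiff]
    rcases he with he | he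
    · rcases ih (by omega) he.1 with h1 | h1
      · exact Or.inl ⟨h1, he.2⟩
      · exact Or.inr h1
    · right
      -- The accepted token reverses an edge from `out` of the far end, where the difference was at
      -- least the bias; from this end both have the opposite sign.
      have h1 := (hc.mem_inn e).1 (hc.acceptedAt_sub hm _ he)
      have h2 := (h.of_mem_out_phaseState hrev hside hlam (by omega) _ h1).2
      rw [dartBias_rev hrev hside hlam, dartDiff_rev hrev] at h2
      linarith

/-- In the first case the old difference was at most the bias, and every count stays between its
base and its base plus `cap i`. In the second the edge was never flipped although it could have
been, and `surplus_le` applies. -/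
theorem dartDiff_phase (h : Compatible rev P side lam (i * (P.rounds + 1)) s)
    (hrev : ∀ e, rev (rev e) = e) (hside : ∀ e, side (rev e).1 = !side e.1)
    (hlam : ∀ e, lam (rev e) = lam e) (hratio : 0 < P.ratio) (hrounds : 0 < P.rounds)
    (e : Σ v, Fin (deg v)) (he : e.2 ∈ (phaseState rev s P.rounds e.1).towards) :
    dartDiff rev (phaseState rev s P.rounds) e ≤ dartBias rev P side lam e + P.cap i ∨
    e.2 ∈ (s e.1).towards ∧ dartDiff rev (phaseState rev s P.rounds) e ≤
      dartDiff rev s e + (2 * P.bandwidth (deg e.1) + 2 * P.bandwidth (deg (rev e).1) +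
        P.retire i * (P.ratio + 2) ^ 2) := by
  have td := h.tokenDropping hrev hside hlam hratio hrounds
  rcases h.of_mem_towards_phaseState hrev hside hlam le_rfl e he with h1 | h1
  · right
    refine ⟨(h.of_mem_out_phaseState hrev hside hlam le_rfl e h1).1, ?_⟩
    have h2 := td.surplus_le e h1
    have h3 : ((_ : ℕ) : ℝ) ≤ ((_ : ℕ) : ℝ) := Nat.cast_le.2 h2
    push_cast at h3
    unfold dartDiff
    linarith
  · left
    have h2 : ((_ : ℕ) : ℝ) ≤ ((_ : ℕ) : ℝ) := Nat.cast_le.2 (td.cnt_le e.1 le_rfl)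
    have h3 : ((_ : ℕ) : ℝ) ≤ ((_ : ℕ) : ℝ) := Nat.cast_le.2 (td.le_cnt (rev e).1 le_rfl)
    push_cast at h2 h3
    have h4 : (0 : ℝ) ≤ (phaseState rev s P.rounds (rev e).1).retired := Nat.cast_nonneg _
    unfold dartDiff at h1 ⊢
    linarith

end Compatible

/-! ### The invariant of the phases -/

namespace BalancingParams

variable (P)

/-- An upper bound on `P.cap i` for phases in which edges with degree sum `D` take part. -/
noncomputable def capBound (D : ℕ) : ℝ := D / P.scale + 1

/-- The increase of the imbalance of an edge with degree sum `D` during a phase. -/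
noncomputable def phaseError (D : ℕ) : ℝ :=
  2 * D / P.ratio + 4 + (P.capBound D / P.rounds + 1) * (P.ratio + 2) ^ 2

variable {P}

theorem Eligible.cap_le (hs : 0 < P.scale) {D : ℕ} (h : P.Eligible i D) :
    (P.cap i : ℝ) ≤ P.capBound D := by
  have hs' : (0 : ℝ) < P.scale := Nat.cast_pos.2 hs
  have h1 : ((P.scale * P.cap i : ℕ) : ℝ) ≤ ((D + P.scale : ℕ) : ℝ) := Nat.cast_le.2 h
  push_cast at h1
  unfold capBound
  rw [div_add_one hs'.ne', le_div_iff₀ hs']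
  linarith

theorem Eligible.mono (hcap : Antitone P.cap) {D j : ℕ} (h : P.Eligible i D) (hij : i ≤ j) :
    P.Eligible j D :=
  (Nat.mul_le_mul_left _ (hcap hij)).trans h

theorem bandwidth_le (d : ℕ) : (P.bandwidth d : ℝ) ≤ d / P.ratio + 1 := by
  unfold bandwidth
  push_cast
  gcongr
  exact Nat.cast_div_le

theorem retire_le (i : ℕ) : (P.retire i : ℝ) ≤ P.cap i / P.rounds + 1 := by
  unfold retire
  push_cast
  gcongr
  exact Nat.cast_div_le

theorem phaseError_nonneg (D : ℕ) : 0 ≤ P.phaseError D := by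
  unfold phaseError capBound
  positivity

theorem Eligible.error_le (hs : 0 < P.scale) {d d' : ℕ}
    (h : P.Eligible i (d + d')) :
    2 * (P.bandwidth d : ℝ) + 2 * P.bandwidth d' + P.retire i * (P.ratio + 2) ^ 2 ≤
      P.phaseError (d + d') := by
  have h1 := bandwidth_le (P := P) d
  have h2 := bandwidth_le (P := P) d'
  have h3 : (P.retire i : ℝ) * (P.ratio + 2) ^ 2 ≤
      (P.capBound (d + d') / P.rounds + 1) * (P.ratio + 2) ^ 2 := by
    refine mul_le_mul_of_nonneg_right ((retire_le i).trans ?_) (by positivity)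
    have := h.cap_le hs
    gcongr
  unfold phaseError
  have h4 : 2 * ((d + d' : ℕ) : ℝ) / P.ratio = 2 * (d / P.ratio) + 2 * (d' / P.ratio) := by
    push_cast
    ring
  rw [h4]
  linarith

end BalancingParams

open scoped Classical in
/-- The invariant that holds after `n` phases. -/
structure BalancingInvariant (rev : (Σ v, Fin (deg v)) → Σ v, Fin (deg v)) (P : BalancingParams)
    (side : V → Bool) (lam : (Σ v, Fin (deg v)) → ℝ) (n : ℕ)
    (s : ∀ v, BalancingState (deg v)) : Prop where
  compatible : Compatible rev P side lam (n * (P.rounds + 1)) s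
  eligible : ∀ e : Σ v, Fin (deg v), e.2 ∈ (s e.1).towards ∪ (s e.1).away →
    P.Eligible n (degSum rev e)
  diff_le : ∀ e : Σ v, Fin (deg v), e.2 ∈ (s e.1).towards →
    dartDiff rev s e ≤ dartBias rev P side lam e + P.capBound (degSum rev e) +
      n * P.phaseError (degSum rev e)
  sum_le : ∀ e : Σ v, Fin (deg v), e.2 ∉ (s e.1).towards ∪ (s e.1).away →
    ∑ j ∈ Finset.range n with P.Eligible j (degSum rev e), P.cap j ≤
      decided (s e.1) + decided (s (rev e).1)

/-- The cap enters the imbalance only once: a phase either resets the bound to bias plus the current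
cap, or adds a single `phaseError` to the old one. -/
theorem BalancingInvariant.phase {n : ℕ} (h : BalancingInvariant rev P side lam n s)
    (hrev : ∀ e, rev (rev e) = e) (hside : ∀ e, side (rev e).1 = !side e.1)
    (hlam : ∀ e, lam (rev e) = lam e) (hratio : 0 < P.ratio) (hrounds : 0 < P.rounds)
    (hscale : 0 < P.scale) (hcap : Antitone P.cap) :
    BalancingInvariant rev P side lam (n + 1) ((balancing.step rev)^[P.rounds + 1] s) := by
  have hc := h.compatible
  have hmod : n * (P.rounds + 1) % (P.rounds + 1) = 0 := Nat.mul_mod_left _ _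
  have hunion := fun v => hc.union_phaseState hrev hside hlam le_rfl v
  change BalancingInvariant rev P side lam (n + 1) (phaseState rev s P.rounds)
  have helig : ∀ e : Σ v, Fin (deg v), e.2 ∈ (phaseState rev s P.rounds e.1).towards ∪
      (phaseState rev s P.rounds e.1).away → P.Eligible n (degSum rev e) := by
    intro e he
    rw [hunion, hc.towards_step_setup hmod, Finset.mem_union, Finset.mem_union,
      hc.mem_away_step_setup hmod] at he
    rcases he with (he | he) | (he | he)
    · exact h.eligible e (Finset.mem_union_left _ he)
    · have := (hc.mem_proposals_of_mem hmod he).2.1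
      rwa [phase_start_div] at this
    · exact h.eligible e (Finset.mem_union_right _ he)
    · have := (hc.mem_proposals_of_mem hmod he).2.1
      rwa [phase_start_div, degSum_rev hrev] at this
  refine ⟨?_, ?_, ?_, ?_⟩
  · have := hc.compatible_phaseState hrev hside hlam (le_refl P.rounds)
    rwa [show n * (P.rounds + 1) + 1 + P.rounds = (n + 1) * (P.rounds + 1) by ring] at this
  · exact fun e he => (helig e he).mono hcap (Nat.le_succ n)
  · intro e he
    have hel := helig e (Finset.mem_union_left _ he)
    have h0 := P.phaseError_nonneg (degSum rev e)
    have h0' : 0 ≤ (n : ℝ) * P.phaseError (degSum rev e) := by positivity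
    have h1 := hel.cap_le hscale
    have h2 := hel.error_le hscale
    change _ ≤ P.phaseError (degSum rev e) at h2
    push_cast
    rcases hc.dartDiff_phase hrev hside hlam hratio hrounds e he with h3 | ⟨h3, h4⟩
    · linarith
    · have := h.diff_le e h3
      linarith
  · intro e he
    have hdec : ∀ v, decided (phaseState rev s P.rounds v) = decided (balancing.step rev s v) :=
      fun v => congrArg Finset.card (hunion v)
    rw [hdec, hdec]
    rw [hunion, Finset.mem_union, not_or] at he
    have hold : e.2 ∉ (s e.1).towards ∪ (s e.1).away := by
      rw [hc.towards_step_setup hmod, hc.mem_away_step_setup hmod, Finset.mem_union] at he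
      rw [Finset.mem_union]
      tauto
    have h1 := h.sum_le e hold
    have h2 := hc.decided_step_setup hmod e.1
    have h3 := hc.decided_step_setup hmod (rev e).1
    rw [Finset.range_add_one, Finset.filter_insert]
    split_ifs with hel
    · rw [Finset.sum_insert (by simp)]
      -- This is the only place where the sum of caps grows, and the decided edges at the two ends
      -- grow by at least as much.
      have h4 := hc.progress_setup hmod hrev hside hlam (by rwa [phase_start_div]) he.1 he.2
      rw [phase_start_div] at h4
      omega
    · omega

theorem BalancingInvariant.iterate (h : BalancingInvariant rev P side lam 0 s)
    (hrev : ∀ e, rev (rev e) = e) (hside : ∀ e, side (rev e).1 = !side e.1)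
    (hlam : ∀ e, lam (rev e) = lam e) (hratio : 0 < P.ratio) (hrounds : 0 < P.rounds)
    (hscale : 0 < P.scale) (hcap : Antitone P.cap) (n : ℕ) :
    BalancingInvariant rev P side lam n ((balancing.step rev)^[n * (P.rounds + 1)] s) := by
  induction n with
  | zero => simpa using h
  | succ n ih =>
    rw [show (n + 1) * (P.rounds + 1) = (P.rounds + 1) + n * (P.rounds + 1) by ring,
      Function.iterate_add_apply]
    exact ih.phase hrev hside hlam hratio hrounds hscale hcap

theorem BalancingInvariant.initial (par_eq : ∀ v, (s v).par = P) (time_eq : ∀ v, (s v).time = 0)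
    (side_eq : ∀ v, (s v).side = side v) (lam_eq : ∀ v i, (s v).lam i = lam ⟨v, i⟩)
    (towards_eq : ∀ v, (s v).towards = ∅) (away_eq : ∀ v, (s v).away = ∅)
    (out_eq : ∀ v, (s v).out = ∅) (inn_eq : ∀ v, (s v).inn = ∅) :
    BalancingInvariant rev P side lam 0 s where
  compatible := by
    constructor <;> simp [*]
  eligible := by simp [*]
  diff_le := by simp [*]
  sum_le := by simp

end Phase

/-! ## Edges of a port-numbered graph -/

section Ports

variable {V : Type*} [Fintype V] {G : SimpleGraph V} [DecidableRel G.Adj]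

theorem PortNumbering.edge_injective (port : PortNumbering G) (v : V) :
    Function.Injective (port.edge v) := by
  intro i j h
  have h1 : s(v, port.nbr v i) = s(v, port.nbr v j) := congrArg Subtype.val h
  exact (port v).injective (Subtype.ext (Sym2.congr_right.1 h1))

theorem PortNumbering.exists_edge_eq (port : PortNumbering G) {v : V} {f : G.edgeSet}
    (h : v ∈ (f : Sym2 V)) : ∃ i, port.edge v i = f := by
  obtain ⟨f, hf⟩ := f
  obtain ⟨w, rfl⟩ := Sym2.mem_iff_exists.1 h
  refine ⟨(port v).symm ⟨w, hf⟩, Subtype.ext ?_⟩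
  simp [PortNumbering.edge, PortNumbering.nbr]

theorem PortNumbering.edge_rev (port : PortNumbering G) (e : Σ v, Fin (G.degree v)) :
    port.edge (port.rev e).1 (port.rev e).2 = port.edge e.1 e.2 := by
  have h1 : port.nbr (port.rev e).1 (port.rev e).2 = e.1 :=
    congrArg Subtype.val (Equiv.apply_symm_apply _ _)
  refine Subtype.ext ?_
  change s((port.rev e).1, port.nbr (port.rev e).1 (port.rev e).2) = s(e.1, port.nbr e.1 e.2)
  rw [h1, Sym2.eq_swap]
  rfl

theorem PortNumbering.eq_or_eq_rev (port : PortNumbering G) {e e' : Σ v, Fin (G.degree v)}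
    (h : port.edge e.1 e.2 = port.edge e'.1 e'.2) : e' = e ∨ e' = port.rev e := by
  have h1 : e'.1 ∈ (port.edge e.1 e.2 : Sym2 V) := by
    rw [h]
    exact Sym2.mem_mk_left _ _
  have key : ∀ f : Σ v, Fin (G.degree v), e'.1 = f.1 →
      port.edge e'.1 e'.2 = port.edge f.1 f.2 → e' = f := by
    rintro ⟨v, i⟩ hv hf
    obtain ⟨v', j⟩ := e'
    obtain rfl : v' = v := hv
    obtain rfl : j = i := port.edge_injective _ hf
    rfl
  rcases Sym2.mem_iff.1 h1 with h2 | h2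
  · exact Or.inl (key e h2 h.symm)
  · exact Or.inr (key (port.rev e) h2 (by rw [port.edge_rev, h]))

open scoped Classical in
/-- Counting the neighbors of an edge with a given property at its two endpoints. -/
theorem PortNumbering.ncard_lineGraph_adj (port : PortNumbering G) (e : Σ v, Fin (G.degree v))
    (p : G.edgeSet → Prop) (hp : p (port.edge e.1 e.2)) :
    {f | G.lineGraph.Adj (port.edge e.1 e.2) f ∧ p f}.ncard + 2 =
      (Finset.univ.filter fun i => p (port.edge e.1 i)).card +
      (Finset.univ.filter fun i => p (port.edge (port.rev e).1 i)).card := by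
  obtain ⟨v, i⟩ := e
  set w := (port.rev ⟨v, i⟩).1 with hw
  have hadj : G.Adj v w := port.adj_nbr v i
  set A := (Finset.univ.filter fun i => p (port.edge v i)).image (port.edge v) with hA
  set B := (Finset.univ.filter fun i => p (port.edge w i)).image (port.edge w) with hB
  have mem : ∀ (x : V) (f : G.edgeSet),
      f ∈ (Finset.univ.filter fun i => p (port.edge x i)).image (port.edge x) ↔
        p f ∧ x ∈ (f : Sym2 V) := by
    intro x f
    simp only [Finset.mem_image, Finset.mem_filter, Finset.mem_univ, true_and]
    constructor
    · rintro ⟨j, hj, rfl⟩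
      exact ⟨hj, Sym2.mem_mk_left _ _⟩
    · rintro ⟨h1, h2⟩
      obtain ⟨j, rfl⟩ := port.exists_edge_eq h2
      exact ⟨j, h1, rfl⟩
  have hev : (port.edge v i : Sym2 V) = s(v, w) := rfl
  -- The graph is simple, so the two ends share no edge except `e`. It is counted at both ends and
  -- is no neighbor of itself, hence the `+ 2`.
  have hinter : A ∩ B = {port.edge v i} := by
    ext f
    rw [Finset.mem_inter, mem, mem, Finset.mem_singleton]
    constructor
    · rintro ⟨⟨_, h1⟩, _, h2⟩
      exact Subtype.ext ((Sym2.mem_and_mem_iff hadj.ne).1 ⟨h1, h2⟩)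
    · rintro rfl
      exact ⟨⟨hp, hev ▸ Sym2.mem_mk_left _ _⟩, hp, hev ▸ Sym2.mem_mk_right _ _⟩
  have hset : {f | G.lineGraph.Adj (port.edge v i) f ∧ p f} =
      (((A ∪ B).erase (port.edge v i) : Finset G.edgeSet) : Set G.edgeSet) := by
    ext f
    rw [Set.mem_ofPred_eq, Finset.mem_coe, Finset.mem_erase, Finset.mem_union, mem, mem,
      SimpleGraph.lineGraph_adj_iff_exists, ne_comm]
    constructor
    · rintro ⟨⟨h1, x, h2, h3⟩, h4⟩
      refine ⟨h1, ?_⟩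
      rw [hev, Sym2.mem_iff] at h2
      rcases h2 with rfl | rfl
      · exact Or.inl ⟨h4, h3⟩
      · exact Or.inr ⟨h4, h3⟩
    · rintro ⟨h1, ⟨h2, h3⟩ | ⟨h2, h3⟩⟩
      · exact ⟨⟨h1, v, hev ▸ Sym2.mem_mk_left _ _, h3⟩, h2⟩
      · exact ⟨⟨h1, w, hev ▸ Sym2.mem_mk_right _ _, h3⟩, h2⟩
  have hmem : port.edge v i ∈ A ∪ B :=
    Finset.mem_of_mem_inter_left (hinter ▸ Finset.mem_singleton_self _ : _ ∈ A ∩ B) |>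
      Finset.mem_union_left _
  have hcard := Finset.card_union_add_card_inter A B
  rw [hinter, Finset.card_singleton, hA, Finset.card_image_of_injective _ (port.edge_injective v),
    hB, Finset.card_image_of_injective _ (port.edge_injective w), ← hA, ← hB] at hcard
  have hpos := Finset.card_pos.2 ⟨_, hmem⟩
  rw [hset, Set.ncard_coe_finset, Finset.card_erase_of_mem hmem]
  change _ = (Finset.univ.filter fun i => p (port.edge v i)).card + _
  omega

theorem PortNumbering.edgeDegree_add_two (port : PortNumbering G) (e : Σ v, Fin (G.degree v)) :
    edgeDegree G (port.edge e.1 e.2) + 2 = degSum port.rev e := by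
  have := port.ncard_lineGraph_adj e (fun _ => True) trivial
  simpa [edgeDegree, degSum, SimpleGraph.neighborSet] using this

end Ports

/-! ## The edge colors -/

/-- The color of the edges oriented towards the nodes of a side. -/
def sideColor (side : Bool) : EdgeColor := if side then .red else .blue

theorem sideColor_injective : Function.Injective sideColor := by
  intro a b
  cases a <;> cases b <;> simp [sideColor]

/-- The color that a node gives to the edge at a port. -/
def BalancingState.color {d : ℕ} (s : BalancingState d) (i : Fin d) : EdgeColor :=
  if i ∈ s.towards then sideColor s.side else if i ∈ s.away then sideColor (!s.side) else .red

section Coloring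

variable {V : Type*} [Fintype V] {G : SimpleGraph V} [DecidableRel G.Adj]
  {port : PortNumbering G} {P : BalancingParams} {side : V → Bool}
  {lam : (Σ v, Fin (G.degree v)) → ℝ} {t : ℕ} {s : ∀ v, BalancingState (G.degree v)}

theorem Compatible.color_rev (h : Compatible port.rev P side lam t s)
    (hside : ∀ e, side (port.rev e).1 = !side e.1) (e : Σ v, Fin (G.degree v)) :
    (s (port.rev e).1).color (port.rev e).2 = (s e.1).color e.2 := by
  have h1 := h.mem_away e
  have h2 := h.mem_away_rev port.rev_rev e
  have h3 := h.notMem_away e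
  unfold BalancingState.color
  simp only [← h1, h2, h.side_eq, hside, Bool.not_not]
  by_cases h4 : e.2 ∈ (s e.1).towards
  · simp [h3 h4, h4]
  -- Undecided edges get the default color red at both ends, so the ends agree even then.
  · simp [h4]

open scoped Classical in
/-- The edge coloring described by the states of the nodes. -/
noncomputable def edgeColoring (port : PortNumbering G) (s : ∀ v, BalancingState (G.degree v))
    (f : G.edgeSet) : EdgeColor :=
  if h : ∃ e : Σ v, Fin (G.degree v), port.edge e.1 e.2 = f then
    (s h.choose.1).color h.choose.2 else .red

theorem Compatible.edgeColoring_edge (h : Compatible port.rev P side lam t s)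
    (hside : ∀ e, side (port.rev e).1 = !side e.1) (e : Σ v, Fin (G.degree v)) :
    edgeColoring port s (port.edge e.1 e.2) = (s e.1).color e.2 := by
  have hex : ∃ e' : Σ v, Fin (G.degree v), port.edge e'.1 e'.2 = port.edge e.1 e.2 := ⟨e, rfl⟩
  rw [edgeColoring, dif_pos hex]
  rcases port.eq_or_eq_rev hex.choose_spec with h1 | h1
  · rw [← h1]
  · have h2 := h.color_rev hside hex.choose
    rw [← h1] at h2
    exact h2.symm

open scoped Classical in
/-- If all edges are decided, the number of neighbors of the same color is determined by the
imbalance of the edge. -/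
theorem Compatible.numNeighborsOfColor_add_two (h : Compatible port.rev P side lam t s)
    (hside : ∀ e, side (port.rev e).1 = !side e.1)
    (hall : ∀ v i, i ∈ (s v).towards ∪ (s v).away)
    {e : Σ v, Fin (G.degree v)} (he : e.2 ∈ (s e.1).towards) :
    (numNeighborsOfColor G (edgeColoring port s) (port.edge e.1 e.2) (sideColor (side e.1)) : ℝ) + 2
      = dartDiff port.rev s e + G.degree (port.rev e).1 := by
  have hcol : ∀ v i, edgeColoring port s (port.edge v i) = (s v).color i :=
    fun v i => h.edgeColoring_edge hside ⟨v, i⟩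
  have h1 := port.ncard_lineGraph_adj e
    (fun f => edgeColoring port s f = sideColor (side e.1))
    (by rw [hcol, BalancingState.color, if_pos he, h.side_eq])
  have hne : ∀ b, sideColor (!b) ≠ sideColor b := by
    intro b hb
    have := sideColor_injective hb
    simp at this
  have h2 : (Finset.univ.filter fun i =>
      edgeColoring port s (port.edge e.1 i) = sideColor (side e.1)) = (s e.1).towards := by
    ext i
    have := hall e.1 i
    rw [Finset.mem_union] at this
    simp only [Finset.mem_filter, Finset.mem_univ, true_and, hcol, BalancingState.color, h.side_eq]
    split_ifs with h3 h4
    · simp [h3]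
    · simp [h3, hne]
    · tauto
  -- At the tail the orientation is read from the other side of the bipartition: the edges of the
  -- given color are those oriented away, the complement of `towards` because all edges are decided.
  have h3 : (Finset.univ.filter fun i =>
      edgeColoring port s (port.edge (port.rev e).1 i) = sideColor (side e.1)) =
        (s (port.rev e).1).towardsᶜ := by
    ext i
    have := hall (port.rev e).1 i
    rw [Finset.mem_union] at this
    simp only [Finset.mem_filter, Finset.mem_univ, true_and, hcol, BalancingState.color, h.side_eq,
      Finset.mem_compl, hside, Bool.not_not]
    split_ifs with h3 h4
    · simp [h3, hne]
    · simp [h3]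
    · tauto
  rw [h2, h3, Finset.card_compl, Fintype.card_fin] at h1
  have h4 := Finset.card_le_univ (s (port.rev e).1).towards
  rw [Fintype.card_fin] at h4
  have h5 : numNeighborsOfColor G (edgeColoring port s) (port.edge e.1 e.2) (sideColor (side e.1))
      + 2 + (s (port.rev e).1).towards.card =
        (s e.1).towards.card + G.degree (port.rev e).1 := by
    unfold numNeighborsOfColor
    omega
  have h6 : ((_ : ℕ) : ℝ) = ((_ : ℕ) : ℝ) := congrArg Nat.cast h5
  push_cast at h6
  unfold dartDiff
  linarith

theorem numNeighborsOfColor_le_edgeDegree (G : SimpleGraph V) (col : G.edgeSet → EdgeColor)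
    (f : G.edgeSet) (c : EdgeColor) : numNeighborsOfColor G col f c ≤ edgeDegree G f :=
  Set.ncard_le_ncard (fun _ h => h.1) (Set.toFinite _)

end Coloring

/-! ## The choice of the parameters -/

section Parameters

/-- An integer that is at least `1 / ε`. -/
noncomputable def invEps (ε : ℝ) : ℕ := ⌈1 / ε⌉₊

/-- The number of phases with equal cap. -/
noncomputable def stageLength (ε : ℝ) : ℕ := 32 * invEps ε

/-- The number of phases. -/
noncomputable def numPhases (ε : ℝ) (Δ : ℕ) : ℕ := (Nat.log 2 Δ + 2) * stageLength ε

/-- The ratio between the degree of a node and its bandwidth. -/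
noncomputable def dropRatio (ε : ℝ) (Δ : ℕ) : ℕ := 16 * numPhases ε Δ * invEps ε

/-- The number of rounds of token dropping in a phase. -/
noncomputable def dropRounds (ε : ℝ) (Δ : ℕ) : ℕ := numPhases ε Δ * (dropRatio ε Δ + 2) ^ 2

/-- The constant in the additive defect. -/
def defectConst : ℝ := 10 * 192 * 6912 ^ 2

/-- The additive defect. -/
noncomputable def defect (ε : ℝ) (Δ : ℕ) : ℝ := defectConst * (Real.logb 2 Δ ^ 3 / ε ^ 5)

/-- The parameters of the balancing algorithm that computes a defective coloring. -/
noncomputable def defectiveParams (ε : ℝ) (Δ : ℕ) : BalancingParams where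
  ratio := dropRatio ε Δ
  rounds := dropRounds ε Δ
  scale := 16 * invEps ε
  cap i := 2 ^ (Nat.log 2 Δ + 1 - i / stageLength ε)
  threshold lam D := lam * ((1 + ε) * ((D : ℝ) - 2) + defect ε Δ) -
    (ε * ((D : ℝ) - 2) + defect ε Δ) / 2

/-! ### Size of the parameters -/

variable {ε : ℝ} {Δ : ℕ}

theorem invEps_pos (hε : 0 < ε) : 0 < invEps ε := Nat.ceil_pos.2 (by positivity)

theorem one_div_invEps_le (hε : 0 < ε) : 1 / (invEps ε : ℝ) ≤ ε := by
  have h1 : 1 / ε ≤ invEps ε := Nat.le_ceil _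
  have h2 : (0 : ℝ) < invEps ε := Nat.cast_pos.2 (invEps_pos hε)
  rw [div_le_iff₀ h2]
  rwa [div_le_iff₀ hε, mul_comm] at h1

theorem invEps_le (hε : 0 < ε) (hε' : ε ≤ 1) : (invEps ε : ℝ) ≤ 2 / ε := by
  have h1 : (invEps ε : ℝ) < 1 / ε + 1 := Nat.ceil_lt_add_one (by positivity)
  have h2 : 1 ≤ 1 / ε := by rwa [le_div_iff₀ hε, one_mul]
  have h3 : 2 / ε = 1 / ε + 1 / ε := by ring
  linarith

theorem stageLength_pos (hε : 0 < ε) : 0 < stageLength ε := by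
  have := invEps_pos hε
  unfold stageLength
  omega

theorem numPhases_pos (hε : 0 < ε) : 0 < numPhases ε Δ :=
  Nat.mul_pos (by omega) (stageLength_pos hε)

theorem dropRatio_pos (hε : 0 < ε) : 0 < dropRatio ε Δ :=
  Nat.mul_pos (Nat.mul_pos (by omega) (numPhases_pos hε)) (invEps_pos hε)

theorem dropRounds_pos (hε : 0 < ε) : 0 < dropRounds ε Δ :=
  Nat.mul_pos (numPhases_pos hε) (by positivity)

theorem one_le_logb (hΔ : 2 ≤ Δ) : 1 ≤ Real.logb 2 Δ := by
  rw [Real.le_logb_iff_rpow_le (by norm_num) (by positivity), Real.rpow_one]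
  exact_mod_cast hΔ

theorem numPhases_le (hε : 0 < ε) (hε' : ε ≤ 1) (hΔ : 2 ≤ Δ) :
    (numPhases ε Δ : ℝ) ≤ 192 * (Real.logb 2 Δ / ε) := by
  have h1 := one_le_logb hΔ
  have h2 : (Nat.log 2 Δ : ℝ) ≤ Real.logb 2 Δ := by
    simpa using Real.natLog_le_logb Δ 2
  have h3 := invEps_le hε hε'
  unfold numPhases stageLength
  push_cast
  -- Here 192 = 3 · 32 · 2, with the factor 3 from `Nat.log 2 Δ + 2 ≤ 3 * Real.logb 2 Δ` and the
  -- factor 2 from `invEps_le`.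
  calc ((Nat.log 2 Δ : ℝ) + 2) * (32 * invEps ε)
      ≤ (3 * Real.logb 2 Δ) * (32 * (2 / ε)) := by
        gcongr
        linarith
    _ = 192 * (Real.logb 2 Δ / ε) := by ring

theorem dropRatio_add_two_le (hε : 0 < ε) (hε' : ε ≤ 1) (hΔ : 2 ≤ Δ) :
    (dropRatio ε Δ : ℝ) + 2 ≤ 6912 * (Real.logb 2 Δ / ε ^ 2) := by
  have h1 := numPhases_le hε hε' hΔ
  have h2 := invEps_le hε hε'
  have h3 : (1 : ℝ) ≤ numPhases ε Δ * invEps ε := by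
    exact_mod_cast Nat.mul_pos (numPhases_pos hε) (invEps_pos hε)
  have h4 := one_le_logb hΔ
  unfold dropRatio
  push_cast
  -- The summand 2 is absorbed by a product that is at least 1, which turns 16 into 18; then 6912 =
  -- 18 · 192 · 2.
  calc 16 * (numPhases ε Δ : ℝ) * invEps ε + 2 ≤ 18 * (numPhases ε Δ * invEps ε) := by linarith
    _ ≤ 18 * (192 * (Real.logb 2 Δ / ε) * (2 / ε)) := by gcongr
    _ = 6912 * (Real.logb 2 Δ / ε ^ 2) := by
      field_simp
      norm_num

theorem dropRounds_le (hε : 0 < ε) (hε' : ε ≤ 1) (hΔ : 2 ≤ Δ) :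
    (dropRounds ε Δ : ℝ) ≤ 192 * 6912 ^ 2 * (Real.logb 2 Δ ^ 3 / ε ^ 5) := by
  have h1 := numPhases_le hε hε' hΔ
  have h2 := dropRatio_add_two_le hε hε' hΔ
  have h4 := one_le_logb hΔ
  unfold dropRounds
  push_cast
  calc (numPhases ε Δ : ℝ) * (dropRatio ε Δ + 2) ^ 2
      ≤ 192 * (Real.logb 2 Δ / ε) * (6912 * (Real.logb 2 Δ / ε ^ 2)) ^ 2 := by gcongr
    _ = 192 * 6912 ^ 2 * (Real.logb 2 Δ ^ 3 / ε ^ 5) := by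
      field_simp

theorem ten_mul_dropRounds_le (hε : 0 < ε) (hε' : ε ≤ 1) (hΔ : 2 ≤ Δ) :
    10 * (dropRounds ε Δ : ℝ) ≤ defect ε Δ := by
  have := dropRounds_le hε hε' hΔ
  unfold defect defectConst
  linarith

theorem total_rounds_le (hε : 0 < ε) (hε' : ε ≤ 1) (hΔ : 2 ≤ Δ) :
    ((3 * (numPhases ε Δ * (dropRounds ε Δ + 1)) : ℕ) : ℝ) ≤
      6 * 192 ^ 2 * 6912 ^ 2 * (Real.logb 2 Δ ^ 4 / ε ^ 6) := by
  have h1 := numPhases_le hε hε' hΔ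
  have h2 := dropRounds_le hε hε' hΔ
  have h3 : (1 : ℝ) ≤ dropRounds ε Δ := by exact_mod_cast dropRounds_pos hε
  have h4 := one_le_logb hΔ
  push_cast
  calc 3 * ((numPhases ε Δ : ℝ) * (dropRounds ε Δ + 1))
      ≤ 3 * (numPhases ε Δ * (2 * dropRounds ε Δ)) := by
        gcongr
        linarith
    _ ≤ 3 * (192 * (Real.logb 2 Δ / ε) *
        (2 * (192 * 6912 ^ 2 * (Real.logb 2 Δ ^ 3 / ε ^ 5)))) := by gcongr
    _ = 6 * 192 ^ 2 * 6912 ^ 2 * (Real.logb 2 Δ ^ 4 / ε ^ 6) := by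
      field_simp
      norm_num

theorem defect_nonneg (hε : 0 < ε) : 0 ≤ defect ε Δ := by
  have h : 0 ≤ Real.logb 2 Δ := by
    rcases Nat.eq_zero_or_pos Δ with rfl | h
    · simp
    · exact Real.logb_nonneg (by norm_num) (by exact_mod_cast h)
  unfold defect defectConst
  positivity

theorem antitone_cap (ε : ℝ) (Δ : ℕ) : Antitone (defectiveParams ε Δ).cap := by
  intro i j hij
  refine Nat.pow_le_pow_right (by norm_num) ?_
  have : i / stageLength ε ≤ j / stageLength ε := Nat.div_le_div_right hij
  omega

open scoped Classical in
/-- The caps of the phases in which an edge takes part exceed its degree sum in total. -/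
theorem lt_sum_cap (hε : 0 < ε) {D : ℕ} (hD : D ≤ 2 * Δ) :
    D < ∑ j ∈ Finset.range (numPhases ε Δ) with (defectiveParams ε Δ).Eligible j D,
      (defectiveParams ε Δ).cap j := by
  set M := 16 * invEps ε with hM
  have hQ := invEps_pos hε
  set l := Nat.log 2 Δ + 1 with hl
  have hΔ : Δ < 2 ^ l := Nat.lt_pow_succ_log_self (by norm_num) Δ
  -- The exponent `j` below is the largest with `M * 2 ^ j ≤ D + M`, so the stage with cap `2 ^ j`
  -- is the first in which the edge takes part.
  set x := (D + M) / M with hx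
  have hx0 : x = D / M + 1 := Nat.add_div_right D (by omega)
  set j := Nat.log 2 x with hj
  have hj1 : 2 ^ j ≤ x := Nat.pow_log_le_self 2 (by rw [hx0]; exact Nat.succ_ne_zero _)
  have hj2 : x < 2 ^ (j + 1) := Nat.lt_pow_succ_log_self (by norm_num) x
  have hjl : j ≤ l := by
    have h1 : D / M ≤ 2 ^ l := by
      refine Nat.div_le_of_le_mul ?_
      calc D ≤ 2 * 2 ^ l := by omega
        _ ≤ M * 2 ^ l := Nat.mul_le_mul_right _ (by omega)
    have h2 : 2 ≤ 2 ^ l := by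
      calc 2 = 2 ^ 1 := rfl
        _ ≤ 2 ^ l := Nat.pow_le_pow_right (by norm_num) (by omega)
    have h3 : x < 2 ^ (l + 1) := by
      rw [pow_succ]
      omega
    have := (Nat.pow_lt_pow_iff_right (a := 2) (by norm_num)).1 (hj1.trans_lt h3)
    omega
  have hstage : stageLength ε = 2 * M := by
    rw [stageLength, hM]
    ring
  have hcap : ∀ i ∈ Finset.Ico ((l - j) * stageLength ε) ((l - j + 1) * stageLength ε),
      (defectiveParams ε Δ).cap i = 2 ^ j := by
    intro i hi
    rw [Finset.mem_Ico] at hi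
    have : i / stageLength ε = l - j := Nat.div_eq_of_lt_le hi.1 hi.2
    change 2 ^ (l - i / stageLength ε) = 2 ^ j
    rw [this]
    congr 1
    omega
  have hsub : Finset.Ico ((l - j) * stageLength ε) ((l - j + 1) * stageLength ε) ⊆
      (Finset.range (numPhases ε Δ)).filter fun i => (defectiveParams ε Δ).Eligible i D := by
    intro i hi
    rw [Finset.mem_filter, Finset.mem_range]
    constructor
    · rw [Finset.mem_Ico] at hi
      refine hi.2.trans_le (Nat.mul_le_mul_right _ ?_)
      omega
    · rw [BalancingParams.Eligible, hcap i hi]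
      change M * 2 ^ j ≤ D + M
      exact (Nat.mul_le_mul_left _ hj1).trans (Nat.mul_div_le _ _)
  refine lt_of_lt_of_le ?_ (Finset.sum_le_sum_of_subset hsub)
  rw [Finset.sum_congr rfl hcap, Finset.sum_const, Nat.card_Ico, smul_eq_mul, ← Nat.sub_mul,
    Nat.add_sub_cancel_left, one_mul, hstage]
  -- The stage consists of `2 * M` phases, so its caps add up to `2 ^ (j + 1) * M`, which exceeds `D
  -- + M` by maximality of `j`.
  have h4 : D + M < 2 ^ (j + 1) * M := (Nat.div_lt_iff_lt_mul (by omega)).1 hj2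
  have h5 : 2 ^ (j + 1) * M = 2 * M * 2 ^ j := by ring
  omega

/-- The total imbalance is within the tolerance. -/
theorem total_error_le (hε : 0 < ε) (hε' : ε ≤ 1) (hΔ : 2 ≤ Δ) (D : ℕ) :
    (defectiveParams ε Δ).capBound D + numPhases ε Δ * (defectiveParams ε Δ).phaseError D ≤
      (ε * ((D : ℝ) - 2) + defect ε Δ) / 2 := by
  have hQ : (1 : ℝ) ≤ invEps ε := by exact_mod_cast invEps_pos hε
  have hN : (1 : ℝ) ≤ numPhases ε Δ := by exact_mod_cast numPhases_pos hε
  have hdef := ten_mul_dropRounds_le hε hε' hΔ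
  have hinv := one_div_invEps_le hε
  have hR : (dropRatio ε Δ : ℝ) = 16 * numPhases ε Δ * invEps ε := by
    unfold dropRatio
    push_cast
    rfl
  have hT : (dropRounds ε Δ : ℝ) = numPhases ε Δ * (dropRatio ε Δ + 2) ^ 2 := by
    unfold dropRounds
    push_cast
    rfl
  set Q : ℝ := (invEps ε : ℝ) with hQdef
  set N : ℝ := (numPhases ε Δ : ℝ) with hNdef
  set R : ℝ := (dropRatio ε Δ : ℝ) with hRdef
  set T : ℝ := (dropRounds ε Δ : ℝ) with hTdef
  have hcb : (defectiveParams ε Δ).capBound D = D / (16 * Q) + 1 := by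
    simp [BalancingParams.capBound, defectiveParams, hQdef]
  have hR0 : 0 < R := by
    rw [hR]
    positivity
  -- The choice `T = N * (R + 2) ^ 2` turns the retirement errors of all phases into one `capBound`
  -- plus `T`.
  have hpe : N * (defectiveParams ε Δ).phaseError D =
      2 * N * D / R + 4 * N + (D / (16 * Q) + 1) + T := by
    rw [BalancingParams.phaseError, hcb]
    change N * (2 * D / R + 4 + ((D / (16 * Q) + 1) / T + 1) * (R + 2) ^ 2) = _
    rw [hT]
    field_simp
    ring
  -- The choice `R = 16 * N * Q` keeps the total bandwidth error a small fraction of `ε * D`.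
  have h1 : 2 * N * D / R = D / (8 * Q) := by
    rw [hR]
    field_simp
    ring
  have hT4 : 4 * N ≤ T := by
    rw [hT]
    nlinarith
  have h2 : (D : ℝ) / Q ≤ ε * D := by
    rw [div_eq_mul_one_div, mul_comm]
    gcongr
  have h3 : (D : ℝ) / (8 * Q) = D / Q / 8 := by
    field_simp
  have h4 : (D : ℝ) / (16 * Q) = D / Q / 16 := by
    field_simp
  have h5 : 0 ≤ (D : ℝ) / Q := by positivity
  -- The terms in `D` sum to `D / (4 * Q) ≤ ε * D / 4`. The constants are at most `2 + 2 * T`, while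
  -- half the defect is at least `5 * T`.
  rw [hpe, hcb, h1, h3, h4]
  linarith

end Parameters

/-! ## The main theorem -/

/-- The initial state of a node. -/
noncomputable def initialState (ε : ℝ) (Δ : ℕ) (side : Bool) {d : ℕ} (lam : Fin d → ℝ) :
    BalancingState d where
  par := defectiveParams ε Δ
  side := side
  lam := lam
  time := 0
  towards := ∅
  away := ∅
  out := ∅
  inn := ∅
  base := 0
  retired := 0

/-- The algorithm that computes a defective 2-edge coloring. -/
noncomputable def defectiveColoring (ε : ℝ) : DistributedAlgorithm Bool ℝ EdgeColor :=
  balancing.compile (fun _ Δ _ side _ lam => initialState ε Δ side lam)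
    (fun _ Δ => 3 * ((if Δ ≤ 1 then 0 else numPhases ε Δ) * (dropRounds ε Δ + 1)))
    BalancingState.color

/-- The factor 2 absorbs the additional bit, since `Real.logb 2 n ≥ 1`. -/
theorem length_bits_le {m n : ℕ} (hn : 2 ≤ n) (hm : m ≤ n) :
    ((Nat.bits m).length : ℝ) ≤ 2 * Real.logb 2 n := by
  have h1 : (Nat.bits m).length ≤ Nat.log 2 n + 1 := by
    rw [Nat.size_eq_bits_len, Nat.size_le]
    exact hm.trans_lt (Nat.lt_pow_succ_log_self (by norm_num) n)
  have h2 : ((_ : ℕ) : ℝ) ≤ ((_ : ℕ) : ℝ) := Nat.cast_le.2 h1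
  have h3 : (Nat.log 2 n : ℝ) ≤ Real.logb 2 n := by simpa using Real.natLog_le_logb n 2
  have h4 := one_le_logb hn
  push_cast at h2
  linarith

theorem messagesBounded_defectiveColoring {V : Type*} [Fintype V] {G : SimpleGraph V}
    [DecidableRel G.Adj] (ε : ℝ) (port : PortNumbering G) (ident : V → ℕ) (side : V → Bool)
    (lam : G.edgeSet → ℝ) :
    (defectiveColoring ε).MessagesBounded port ident side lam
      (2 * Real.logb 2 (Fintype.card V)) := by
  rcases le_or_gt G.maxDegree 1 with hΔ | hΔ
  · intro t ht
    simp [defectiveColoring, BlockAlgorithm.compile, hΔ] at ht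
  have hne : Nonempty V := by
    by_contra hV
    rw [not_nonempty_iff] at hV
    simp at hΔ
  obtain ⟨x, hx⟩ := G.exists_maximal_degree_vertex
  have hn : 2 ≤ Fintype.card V := by
    have := G.degree_lt_card_verts x
    omega
  have hd : ∀ v, G.degree v ≤ Fintype.card V := fun v => (G.degree_lt_card_verts v).le
  refine BlockAlgorithm.messagesBounded_compile _ _ _ _ _ _ _ _ ?_ ?_ ?_
  · intro v s i
    refine length_bits_le hn ?_
    simp only [balancing]
    split_ifs
    · exact hd v
    · omega
    · omega
  · intro v s r i
    refine length_bits_le hn ?_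
    simp only [balancing]
    split_ifs
    · have := Finset.card_le_univ s.towards
      rw [Fintype.card_fin] at this
      exact this.trans (hd v)
    · omega
    · omega
  · intro v s r r' i
    refine length_bits_le hn ?_
    simp only [balancing]
    split_ifs <;> omega

/-! ### From the final invariant to the defect bound -/

section Correctness

variable {V : Type*} [Fintype V] {G : SimpleGraph V} [DecidableRel G.Adj]
  {port : PortNumbering G} {side : V → Bool} {lam : G.edgeSet → ℝ} {ε : ℝ}
  {s : ∀ v, BalancingState (G.degree v)}

/-- The parameter of the edge of a dart. -/
def dartParam (port : PortNumbering G) (lam : G.edgeSet → ℝ) (e : Σ v, Fin (G.degree v)) : ℝ :=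
  lam (port.edge e.1 e.2)

/-- For an undecided edge the ends would have at least as many decided edges as the eligible caps
add up to, which is more than the degree sum. -/
theorem decided_of_invariant (hε : 0 < ε)
    (h : BalancingInvariant port.rev (defectiveParams ε G.maxDegree) side (dartParam port lam)
      (numPhases ε G.maxDegree) s) (v : V) (i : Fin (G.degree v)) :
    i ∈ (s v).towards ∪ (s v).away := by
  by_contra hi
  have h1 := h.sum_le ⟨v, i⟩ hi
  have hdec : ∀ w, decided (s w) ≤ G.degree w := fun w =>
    (Finset.card_le_univ _).trans (Fintype.card_fin _).le
  have h2 := hdec v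
  have h3 := hdec (port.rev ⟨v, i⟩).1
  have h4 := G.degree_le_maxDegree v
  have h5 := G.degree_le_maxDegree (port.rev ⟨v, i⟩).1
  have h6 := lt_sum_cap hε (D := degSum port.rev ⟨v, i⟩) (Δ := G.maxDegree) (by
    unfold degSum
    dsimp only
    omega)
  have h7 : degSum port.rev ⟨v, i⟩ = G.degree v + G.degree (port.rev ⟨v, i⟩).1 := rfl
  dsimp only at h1
  omega

theorem isRelaxedDefective_of_invariant (hε : 0 < ε) (hε' : ε ≤ 1) (hΔ : 2 ≤ G.maxDegree)
    (hside : ∀ e, side (port.rev e).1 = !side e.1)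
    (h : BalancingInvariant port.rev (defectiveParams ε G.maxDegree) side (dartParam port lam)
      (numPhases ε G.maxDegree) s) :
    IsRelaxedDefectiveTwoEdgeColoring G ε (defect ε G.maxDegree) lam (edgeColoring port s) := by
  have hall := decided_of_invariant hε h
  have hc := h.compatible
  have key : ∀ e : Σ v, Fin (G.degree v), e.2 ∈ (s e.1).towards →
      ((edgeColoring port s (port.edge e.1 e.2) = EdgeColor.red →
        (numNeighborsOfColor G (edgeColoring port s) (port.edge e.1 e.2) EdgeColor.red : ℝ) ≤
          (1 + ε) * lam (port.edge e.1 e.2) * edgeDegree G (port.edge e.1 e.2) +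
            lam (port.edge e.1 e.2) * defect ε G.maxDegree) ∧
      (edgeColoring port s (port.edge e.1 e.2) = EdgeColor.blue →
        (numNeighborsOfColor G (edgeColoring port s) (port.edge e.1 e.2) EdgeColor.blue : ℝ) ≤
          (1 + ε) * (1 - lam (port.edge e.1 e.2)) * edgeDegree G (port.edge e.1 e.2) +
            (1 - lam (port.edge e.1 e.2)) * defect ε G.maxDegree)) := by
    intro e he
    have h1 := hc.numNeighborsOfColor_add_two hside hall he
    have h2 := h.diff_le e he
    have h3 := total_error_le hε hε' hΔ (degSum port.rev e)
    have h4 : ((_ : ℕ) : ℝ) = ((_ : ℕ) : ℝ) := congrArg Nat.cast (port.edgeDegree_add_two e)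
    have h5 : edgeColoring port s (port.edge e.1 e.2) = sideColor (side e.1) := by
      rw [hc.edgeColoring_edge hside, BalancingState.color, if_pos he, hc.side_eq]
    have h6 : dartBias port.rev (defectiveParams ε G.maxDegree) side (dartParam port lam) e =
        (defectiveParams ε G.maxDegree).bias (side e.1) (lam (port.edge e.1 e.2)) (G.degree e.1)
          (G.degree (port.rev e).1) := rfl
    have h7 : G.degree e.1 + G.degree (port.rev e).1 = degSum port.rev e := rfl
    have h8 : (G.degree e.1 : ℝ) + G.degree (port.rev e).1 = degSum port.rev e := by
      exact_mod_cast h7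
    push_cast at h4
    rw [h5]
    set μ := lam (port.edge e.1 e.2) with hμ
    set β := defect ε G.maxDegree with hβ
    have h9 : (degSum port.rev e : ℝ) - 2 = edgeDegree G (port.edge e.1 e.2) := by linarith
    rw [BalancingParams.bias, h7] at h6
    -- With `E = (1 + ε) * deg(e) + β` and slack `S = (ε * deg(e) + β) / 2`, the threshold is `μ * E
    -- - S`. An error of at most `S` leaves `μ * E` for red. For blue, the degree sum `deg(e) + 2`
    -- minus the threshold plus `S` is `(1 - μ) * E + 2`.
    have h10 : (defectiveParams ε G.maxDegree).threshold μ (degSum port.rev e) =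
        μ * ((1 + ε) * ((degSum port.rev e : ℝ) - 2) + β) -
          (ε * ((degSum port.rev e : ℝ) - 2) + β) / 2 := rfl
    rw [h10] at h6
    rw [h9] at h6 h3
    cases hs : side e.1
    · refine ⟨fun hr => by simp [sideColor] at hr, fun _ => ?_⟩
      rw [hs] at h1 h6
      simp only [Bool.false_eq_true, if_false] at h6
      change (numNeighborsOfColor G _ _ EdgeColor.blue : ℝ) + 2 = _ at h1
      linarith
    · refine ⟨fun _ => ?_, fun hr => by simp [sideColor] at hr⟩
      rw [hs] at h1 h6
      simp only [if_true] at h6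
      change (numNeighborsOfColor G _ _ EdgeColor.red : ℝ) + 2 = _ at h1
      linarith
  intro f
  obtain ⟨v, hv⟩ : ∃ v, v ∈ (f : Sym2 V) := ⟨_, Sym2.out_fst_mem _⟩
  obtain ⟨i, rfl⟩ := port.exists_edge_eq hv
  -- The estimate is applied at the end towards which the edge is oriented.
  rcases Finset.mem_union.1 (hall v i) with hi | hi
  · exact key ⟨v, i⟩ hi
  · have h1 := key (port.rev ⟨v, i⟩) ((hc.mem_away ⟨v, i⟩).1 hi)
    rwa [port.edge_rev] at h1

/-- With maximum degree at most 1 no edge has a neighbor, so any coloring will do. -/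
theorem isRelaxedDefective_of_maxDegree_le_one (hε : 0 < ε) (port : PortNumbering G)
    (hΔ : G.maxDegree ≤ 1) (hlam : ∀ e, 0 ≤ lam e ∧ lam e ≤ 1) (col : G.edgeSet → EdgeColor) :
    IsRelaxedDefectiveTwoEdgeColoring G ε (defect ε G.maxDegree) lam col := by
  intro f
  have hβ := defect_nonneg (Δ := G.maxDegree) hε
  have h0 : ∀ c, numNeighborsOfColor G col f c = 0 := by
    intro c
    obtain ⟨v, hv⟩ : ∃ v, v ∈ (f : Sym2 V) := ⟨_, Sym2.out_fst_mem _⟩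
    obtain ⟨i, rfl⟩ := port.exists_edge_eq hv
    have h1 := port.edgeDegree_add_two ⟨v, i⟩
    have h2 := numNeighborsOfColor_le_edgeDegree G col (port.edge v i) c
    have h3 := G.degree_le_maxDegree v
    have h4 := G.degree_le_maxDegree (port.rev ⟨v, i⟩).1
    unfold degSum at h1
    dsimp only at h1
    omega
  have hl := hlam f
  have hl' : 0 ≤ 1 - lam f := by linarith
  have hl'' := hl.1
  rw [h0, h0]
  constructor <;> intro _ <;> push_cast <;> positivity

end Correctness

theorem mainTheorem5 :
    ∃ Cround Cdefect Cmsg : ℝ, 0 < Cround ∧ 0 < Cdefect ∧ 0 < Cmsg ∧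
      ∀ (c : ℕ) (ε : ℝ), 0 < ε → ε ≤ 1 →
        ∃ A : DistributedAlgorithm Bool ℝ EdgeColor,
          (∀ n Δ : ℕ, (A.rounds n Δ : ℝ) ≤ Cround * (Real.logb 2 Δ ^ 4 / ε ^ 6)) ∧
          ∀ (V : Type*) [Fintype V] (G : SimpleGraph V) [DecidableRel G.Adj]
            (port : PortNumbering G) (ident : V → ℕ) (side : G.Coloring Bool)
            (lam : G.edgeSet → ℝ),
            Function.Injective ident →
            (∀ v, 1 ≤ ident v ∧ ident v ≤ Fintype.card V ^ c) →
            (∀ e, 0 ≤ lam e ∧ lam e ≤ 1) →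
            A.MessagesBounded port ident side lam (Cmsg * Real.logb 2 (Fintype.card V)) ∧
            ∃ col : G.edgeSet → EdgeColor,
              (∀ (v : V) (i : Fin (G.degree v)),
                A.finalOutput port ident side lam v i = col (port.edge v i)) ∧
              IsRelaxedDefectiveTwoEdgeColoring G ε
                (Cdefect * (Real.logb 2 G.maxDegree ^ 3 / ε ^ 5)) lam col := by
  refine ⟨6 * 192 ^ 2 * 6912 ^ 2, defectConst, 2, by norm_num, by norm_num [defectConst],
    by norm_num, fun c ε hε hε' => ⟨defectiveColoring ε, ?_, ?_⟩⟩
  · intro n Δ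
    change ((3 * ((if Δ ≤ 1 then 0 else numPhases ε Δ) * (dropRounds ε Δ + 1)) : ℕ) : ℝ) ≤ _
    split_ifs with hΔ
    · have : (0 : ℝ) ≤ Real.logb 2 Δ ^ 4 := by positivity
      simp only [zero_mul, mul_zero, Nat.cast_zero]
      positivity
    · exact total_rounds_le hε hε' (by omega)
  intro V _ G _ port ident side lam _ _ hlam
  refine ⟨messagesBounded_defectiveColoring ε port ident side lam, ?_⟩
  have hside : ∀ e, side (port.rev e).1 = !side e.1 := by
    intro e
    have := side.valid (port.adj_nbr e.1 e.2)
    exact Bool.eq_not.2 this.symm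
  have hlam_rev : ∀ e, dartParam port lam (port.rev e) = dartParam port lam e := by
    intro e
    unfold dartParam
    rw [port.edge_rev]
  set P := defectiveParams ε G.maxDegree with hP
  set s₀ : ∀ v, BalancingState (G.degree v) :=
    fun v => initialState ε G.maxDegree (side v) fun i => lam (port.edge v i) with hs₀
  have hinit : BalancingInvariant port.rev P side (dartParam port lam) 0 s₀ :=
    .initial (fun _ => rfl) (fun _ => rfl) (fun _ => rfl) (fun _ _ => rfl) (fun _ => rfl)
      (fun _ => rfl) (fun _ => rfl) (fun _ => rfl)
  have hinv := hinit.iterate port.rev_rev hside hlam_rev (dropRatio_pos hε) (dropRounds_pos hε)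
    (Nat.mul_pos (by norm_num) (invEps_pos hε)) (antitone_cap ε G.maxDegree)
  -- For `Δ ≤ 1` the logarithm vanishes and the round bound is 0, so no phase may be run; all edges
  -- then keep the default color.
  set n := if G.maxDegree ≤ 1 then 0 else numPhases ε G.maxDegree with hn
  refine ⟨edgeColoring port ((balancing.step port.rev)^[n * (P.rounds + 1)] s₀), ?_, ?_⟩
  · intro v i
    rw [(hinv n).compatible.edgeColoring_edge hside ⟨v, i⟩]
    have h1 := balancing.run_compile (fun _ Δ _ side _ lam => initialState ε Δ side lam)
      (fun _ Δ => 3 * ((if Δ ≤ 1 then 0 else numPhases ε Δ) * (dropRounds ε Δ + 1)))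
      BalancingState.color port ident side lam (n * (P.rounds + 1)) v
    exact congrArg (fun x => BalancingState.color x.1 i) h1
  · rcases le_or_gt G.maxDegree 1 with hΔ | hΔ
    · exact isRelaxedDefective_of_maxDegree_le_one hε port hΔ hlam _
    · have h2 := hinv n
      rw [hn, if_neg (by omega)] at h2
      have h3 := isRelaxedDefective_of_invariant hε hε' hΔ hside h2
      rw [hn, if_neg (by omega)]
      exact h3
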